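/- **Setting.** Let $P$ be a poset, regarded as a category with an arrow $p\to q$ iff $p\le q$. It is graded by an order-reversing function $\deg:P\to\mathbb N=\{0,1,2,\dots\}$ with $\deg p=\deg q+1$ whenever $p$ precedes $q$ (that is, $p<q$ with nothing strictly between), and $\{q\mid p\le q\}$ is finite for every $p\in P$. Write $\mathrm{Ob}_n(P)$ for the set of objects of degree $n$, $(p\downarrow P)_n=\{q\mid p\le q,\ \deg q=n\}$ and $(p\downarrow P)_*=\{q\mid p<q\}$. Let $c_{\mathbb Z}:P\to\mathrm{Ab}$ be the constant functor $\mathbb Z$ and $H^n(P;\mathbb Z)=\varprojlim^n c_{\mathbb Z}$ the $n$-th right derived functor of $\varprojlim:\mathrm{Ab}^P\to\mathrm{Ab}$ at $c_{\mathbb Z}$. *Local covering families.* Define $R_0^{p}=1$ and $R_{n+1}^{p}=\sum_{q\in(p\downarrow P)_{n}}R_{n}^q-R_{n}^{p}$. A local covering family consists of subsets $J_n^{p}\subseteq(p\downarrow P)_n$ ($p\in P$, $0\le n\le\deg p$) such that for $0\le n<\deg p$ one has $\bigcup_{q\in J_{n+1}^{p}}(q\downarrow P)_n=(p\downarrow P)_n$,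 and $J_n^q\subseteq J_n^{p}$ for each $q\in J^{p}_{n+1}$. It is adequate if $(p\downarrow P)_*$ is connected whenever $\deg p\ge2$ and $R_n^{p}=\sum_{q\in J_n^{p}}R_n^q$ whenever $n\ge0$ and $\deg p\ge n+1$. *The functors $F_n$.* Put $F_0=c_{\mathbb Z}$ and let $F_{n+1}$ be the object-wise cokernel of the natural transformation $\lambda_n:F_n\to \mathrm{Ker}'_{F_n}$, where $\mathrm{Ker}'_{F_n}(p)=\prod_{q\in(p\downarrow P)_n}F_n(q)$ (with the projections as maps) and $\lambda_n$ has components $F_n(p\to q)$. Let $M_n=\prod_{p\in\mathrm{Ob}_n(P)}F_n(p)$, and let $d_n:M_n\to M_{n+1}$ send $x$ to the family whose component at $p\in\mathrm{Ob}_{n+1}(P)$ is the class of $(x_q)_{q\in(p\downarrow P)_n}$ in $F_{n+1}(p)$. For $S\subseteq \mathrm{Ob}_n(P)$ and $T\subseteq\mathrm{Ob}_{n+1}(P)$ the composite $\prod_{S}F_n(p)\hookrightarrow M_n\xrightarrow{d_n}M_{n+1}\to\prod_{T}F_{n+1}(p)$ is again denoted $d_n$. *Global covering families.* A global covering family is a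 family $K=\{K_n\}_{n\ge0}$, $K_n\subseteq\mathrm{Ob}_n(P)$, such that $\varprojlim F_n\to\prod_{p\in K_n}F_n(p)$ is injective for each $n\ge0$, and $d_{n-1}:\prod_{p\in\mathrm{Ob}_{n-1}(P)\setminus K_{n-1}}F_{n-1}(p)\to\prod_{p\in K_n}F_n(p)$ is pure (its cokernel is a free abelian group) for each $n\ge1$. Its Betti numbers are $b_0^K=\sum_{p\in K_0}R_0^p$ and, for $n\ge1$, $$b_n^K=\sum_{p\in K_{n-1}}R_{n-1}^p-\sum_{p\in\mathrm{Ob}_{n-1}(P)}R_{n-1}^p+\sum_{p\in K_n}R_n^p ,$$ defined whenever these sums have only finitely many nonzero terms. **Theorem 5.5.** Suppose that $P$ has an adequate local covering family, and let $K$ be a global covering family for $P$. Then for every $n\ge1$ the map $d_{n-1}:\prod_{p\in\mathrm{Ob}_{n-1}(P)\setminus K_{n-1}}F_{n-1}(p)\to\prod_{p\in K_n}F_n(p)$ is a split monomorphism. Let $B_n^K$ be its cokernel for $n\ge1$, and $B_0^K=\prod_{p\in K_0}F_0(p)$. The maps $d_n:\prod_{p\in K_n}F_n(p)\to\prod_{p\in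 K_{n+1}}F_{n+1}(p)$ induce homomorphisms $\Omega_n:B_n^K\to B_{n+1}^K$ with $\Omega_{n+1}\Omega_n=0$, and in the cochain complex $$0\to B_0^K\xrightarrow{\Omega_0}B_1^K\xrightarrow{\Omega_1}B_2^K\xrightarrow{\Omega_2}\cdots$$ one has $b_n^K\ge0$ and $B_n^K\cong\mathbb Z^{b_n^K}$ for every $n\ge 0$ for which $b_n^K$ is defined, and the $n$-th cohomology group of this complex is isomorphic to $H^n(P;\mathbb Z)$ for every $n\ge0$. -/

import Mathlib

open CategoryTheory Limits

universe u

namespace PosetCohomology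

/-! ### Graded posets -/

/-- `deg` is a degree function on the poset `P`: it is order reversing, and `deg p = deg q + 1`
whenever `p` precedes `q`. The values are natural numbers. -/
structure IsDegreeFunction {P : Type u} [PartialOrder P] (deg : P → ℕ) : Prop where
  antitone : Antitone deg
  covBy : ∀ p q : P, p ⋖ q → deg p = deg q + 1

/-- The objects of degree `n` of the under category `(p₀ ↓ P)`. -/
def above {P : Type u} [PartialOrder P] (deg : P → ℕ) (n : ℕ) (p₀ : P) : Set P :=
  {q | p₀ ≤ q ∧ deg q = n}

/-! ### Cohomology of a poset: the higher limits of the constant functor -/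

/-- The functor category has enough injectives, being a Grothendieck category. -/
instance instGrothendieck (P : Type u) [PartialOrder P] :
    IsGrothendieckAbelian.{u} (P ⥤ AddCommGrpCat.{u}) := by
  have : IsGrothendieckAbelian.{u} ((Pᵒᵖ)ᵒᵖ ⥤ AddCommGrpCat.{u}) := {
     ab5OfSize := { ofShape := fun J _ _ => inferInstance }
     hasSeparator := Presheaf.hasSeparator _ _ }
  exact IsGrothendieckAbelian.of_equivalence
    ((opOpEquivalence P).congrLeft (E := AddCommGrpCat.{u}))

instance instLimAdditive (P : Type u) [PartialOrder P] :
    (lim : (P ⥤ AddCommGrpCat.{u}) ⥤ AddCommGrpCat.{u}).Additive where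
  map_add := by
    intro X Y f g
    apply limit.hom_ext
    intro j
    simp

/-- The functor of constant value `ℤ` (in the universe of `P`). -/
noncomputable def constZ (P : Type u) [PartialOrder P] : P ⥤ AddCommGrpCat.{u} :=
  (Functor.const P).obj (AddCommGrpCat.of (ULift.{u} ℤ))

/-- `Hⁿ(P; ℤ)`: the `n`-th right derived functor of the inverse limit functor, evaluated at the
constant functor of value `ℤ`. -/
noncomputable def integralCohomology (P : Type u) [PartialOrder P] (n : ℕ) : AddCommGrpCat.{u} :=
  ((lim : (P ⥤ AddCommGrpCat.{u}) ⥤ AddCommGrpCat.{u}).rightDerived n).obj (constZ P)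

/-! ### Local covering families -/

/-- A local covering family; only the sets `J p₀ n` with `n ≤ deg p₀` are relevant. -/
structure IsLocalCoveringFamily {P : Type u} [PartialOrder P] (deg : P → ℕ)
    (J : P → ℕ → Set P) : Prop where
  subset : ∀ (p₀ : P) (n : ℕ), n ≤ deg p₀ → J p₀ n ⊆ above deg n p₀
  cover : ∀ (p₀ : P) (n : ℕ), n < deg p₀ →
    (⋃ p ∈ J p₀ (n + 1), above deg n p) = above deg n p₀
  mono : ∀ (p₀ : P) (n : ℕ), n < deg p₀ → ∀ p ∈ J p₀ (n + 1), J p n ⊆ J p₀ n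

/-- The numbers `R_n^{p₀}`. -/
noncomputable def R {P : Type u} [PartialOrder P] (deg : P → ℕ) : ℕ → P → ℤ
  | 0, _ => 1
  | n + 1, p₀ => (∑ᶠ p ∈ above deg n p₀, R deg n p) - R deg n p₀

/-- A local covering family is adequate if `(p₀ ↓ P)_* = {p | p₀ < p}` is connected for all `p₀`
of degree at least two, and `R_n^{p₀} = ∑_{p ∈ J_n^{p₀}} R_n^p` if `deg p₀ ≥ n + 1`. -/
structure IsAdequate {P : Type u} [PartialOrder P] (deg : P → ℕ)
    (J : P → ℕ → Set P) : Prop extends IsLocalCoveringFamily deg J where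
  connected : ∀ p₀ : P, 2 ≤ deg p₀ → CategoryTheory.IsConnected (Set.Ioi p₀)
  rank_eq : ∀ (n : ℕ) (p₀ : P), n + 1 ≤ deg p₀ → R deg n p₀ = ∑ᶠ p ∈ J p₀ n, R deg n p

/-! ### The sequence of functors `F₀ = c_ℤ, F₁, F₂, …` -/

/-- The functor `Ker'_F` of an `n`-condensed functor `F`: its value at `p₀` is the product of the
groups `F p` over the objects `p ≥ p₀` of degree `n`, and its maps are the projections. -/
def kerPrime {P : Type u} [PartialOrder P] (deg : P → ℕ) (n : ℕ)
    (F : P ⥤ AddCommGrpCat.{u}) : P ⥤ AddCommGrpCat.{u} where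
  obj p₀ := AddCommGrpCat.of (∀ q : above deg n p₀, F.obj q.1)
  map {p₁ _} f := AddCommGrpCat.ofHom
    { toFun := fun x q =>
        (x : ∀ q : above deg n p₁, F.obj q.1) ⟨q.1, f.le.trans q.2.1, q.2.2⟩
      map_zero' := rfl
      map_add' := fun _ _ => rfl }

/-- The diagonal natural transformation `λ : F ⟶ Ker'_F` with components `F(p₀ → p)`. -/
def diag {P : Type u} [PartialOrder P] (deg : P → ℕ) (n : ℕ)
    (F : P ⥤ AddCommGrpCat.{u}) : F ⟶ kerPrime deg n F where
  app p₀ := AddCommGrpCat.ofHom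
    { toFun := fun x q => F.map (homOfLE q.2.1) x
      map_zero' := by funext q; simp
      map_add' := fun x y => by funext q; simp }
  naturality p₁ p₂ f := by
    ext x
    funext q
    change F.map (homOfLE q.2.1) (F.map f x) = F.map (homOfLE (f.le.trans q.2.1)) x
    rw [← ConcreteCategory.comp_apply, ← F.map_comp]
    rfl

/-- The object-wise cokernel of a natural transformation. -/
def coker {P : Type u} [PartialOrder P] {F G : P ⥤ AddCommGrpCat.{u}} (α : F ⟶ G) :
    P ⥤ AddCommGrpCat.{u} where
  obj p := AddCommGrpCat.of (G.obj p ⧸ (α.app p).hom.range)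
  map {p q} f := AddCommGrpCat.ofHom
    (QuotientAddGroup.map (α.app p).hom.range (α.app q).hom.range (G.map f).hom (by
      rintro _ ⟨x, rfl⟩
      exact ⟨F.map f x, by
        rw [← AddCommGrpCat.comp_apply, ← AddCommGrpCat.comp_apply, α.naturality]⟩))
  map_id p := by
    ext x
    simp
  map_comp f g := by
    ext x
    simp

/-- The sequence `F₀ = c_ℤ` and `F_{n+1} = coker (λ_n : F_n ⟶ Ker'_{F_n})`. -/
noncomputable def F {P : Type u} [PartialOrder P] (deg : P → ℕ) : ℕ → (P ⥤ AddCommGrpCat.{u})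
  | 0 => constZ P
  | n + 1 => coker (diag deg n (F deg n))

/-- The projection `π_{n+1} : Ker'_{F_n}(p) → F_{n+1}(p)`. -/
noncomputable def proj {P : Type u} [PartialOrder P] (deg : P → ℕ) (n : ℕ) (p : P) :
    (∀ q : above deg n p, (F deg n).obj q.1) →+ (F deg (n + 1)).obj p :=
  QuotientAddGroup.mk' ((diag deg n (F deg n)).app p).hom.range

/-! ### The cochain groups `∏_{p ∈ Ob_n(P)} F_n(p)` and their differential -/

/-- The product of the groups `F_n(p)` over all objects `p` of degree `n`. -/
abbrev M {P : Type u} [PartialOrder P] (deg : P → ℕ) (n : ℕ) : Type u :=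
  ∀ p : {p : P // deg p = n}, (F deg n).obj p.1

/-- The differential `d_n`: the component of `d_n x` at `p` is the class in `F_{n+1}(p)` of the
family `(x_q)` indexed by the `q ≥ p` of degree `n`. -/
noncomputable def d {P : Type u} [PartialOrder P] (deg : P → ℕ) (n : ℕ) :
    M deg n →+ M deg (n + 1) where
  toFun x p := proj deg n p.1 (fun q => x ⟨q.1, q.2.2⟩)
  map_zero' := by
    funext p
    exact map_zero (proj deg n p.1)
  map_add' x y := by
    funext p
    exact map_add (proj deg n p.1) _ _

/-- The product of the groups `F_n(p)` over the objects `p` of degree `n` which lie in `S`. -/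
abbrev MOn {P : Type u} [PartialOrder P] (deg : P → ℕ) (n : ℕ) (S : Set P) : Type u :=
  ∀ p : {p : P // deg p = n ∧ p ∈ S}, (F deg n).obj p.1

open Classical in
/-- Inclusion of a partial product, by extension with zero. -/
noncomputable def incl {P : Type u} [PartialOrder P] (deg : P → ℕ) (n : ℕ) (S : Set P) :
    MOn deg n S →+ M deg n where
  toFun x p := if h : p.1 ∈ S then x ⟨p.1, p.2, h⟩ else 0
  map_zero' := by
    funext p
    by_cases h : p.1 ∈ S <;> simp [h]
  map_add' x y := by
    funext p
    by_cases h : p.1 ∈ S <;> simp [h]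

/-- Projection onto a partial product. -/
def restr {P : Type u} [PartialOrder P] (deg : P → ℕ) (n : ℕ) (S : Set P) :
    M deg n →+ MOn deg n S where
  toFun x p := x ⟨p.1, p.2.1⟩
  map_zero' := rfl
  map_add' _ _ := rfl

/-- The component of `d_n` from the part of degree `n` in `S` to the part of degree `n + 1`
in `T`. -/
noncomputable def dOn {P : Type u} [PartialOrder P] (deg : P → ℕ) (n : ℕ) (S T : Set P) :
    MOn deg n S →+ MOn deg (n + 1) T :=
  (restr deg (n + 1) T).comp ((d deg n).comp (incl deg n S))

/-! ### Global covering families -/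

/-- A homomorphism of abelian groups is pure if its cokernel is a free abelian group. -/
def IsPure {A B : Type u} [AddCommGroup A] [AddCommGroup B] (f : A →+ B) : Prop :=
  Module.Free ℤ (B ⧸ f.range)

/-- The restriction map from the inverse limit of `F_n` to the part of degree `n` in `S`. -/
noncomputable def limRestr {P : Type u} [PartialOrder P] (deg : P → ℕ) (n : ℕ) (S : Set P) :
    (limit (F deg n) : AddCommGrpCat.{u}) →+ MOn deg n S where
  toFun x p := limit.π (F deg n) p.1 x
  map_zero' := by funext p; simp
  map_add' x y := by funext p; simp

/-- A global covering family. -/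
structure IsGlobalCoveringFamily {P : Type u} [PartialOrder P] (deg : P → ℕ)
    (K : ℕ → Set P) : Prop where
  deg_eq : ∀ n, ∀ p ∈ K n, deg p = n
  injective : ∀ n, Function.Injective (limRestr deg n (K n))
  isPure : ∀ n, IsPure (dOn deg n (K n)ᶜ (K (n + 1)))

/-- The Betti numbers `b_n^K` of the family `K`. -/
noncomputable def betti {P : Type u} [PartialOrder P] (deg : P → ℕ) (K : ℕ → Set P) : ℕ → ℤ
  | 0 => ∑ᶠ p ∈ K 0, R deg 0 p
  | n + 1 => (∑ᶠ p ∈ K n, R deg n p) - (∑ᶠ p ∈ {p : P | deg p = n}, R deg n p)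
      + ∑ᶠ p ∈ K (n + 1), R deg (n + 1) p

/-- The number `b_n^K` is defined: the sums in its definition have only finitely many nonzero
terms. (The sum over `K n` is a partial sum of the one over all objects of degree `n`.) -/
def BettiDefined {P : Type u} [PartialOrder P] (deg : P → ℕ) (K : ℕ → Set P) : ℕ → Prop
  | 0 => (K 0 ∩ Function.support (R deg 0)).Finite
  | n + 1 => ({p : P | deg p = n} ∩ Function.support (R deg n)).Finite ∧
      (K (n + 1) ∩ Function.support (R deg (n + 1))).Finite

/-! ### The groups `B_n^K` -/

/-- The image in `∏_{p ∈ K_n} F_n(p)` of the non-critical part of degree `n - 1` (zero if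
`n = 0`). -/
noncomputable def nonCriticalImage {P : Type u} [PartialOrder P] (deg : P → ℕ) (K : ℕ → Set P) :
    (n : ℕ) → AddSubgroup (MOn deg n (K n))
  | 0 => ⊥
  | n + 1 => (dOn deg n (K n)ᶜ (K (n + 1))).range

/-- The group `B_n^K`: the cokernel of
`∏_{p ∈ Ob_{n-1} \ K_{n-1}} F_{n-1}(p) → ∏_{p ∈ K_n} F_n(p)` for `n ≥ 1`, and
`∏_{p ∈ K_0} F_0(p)` for `n = 0`. -/
noncomputable def B {P : Type u} [PartialOrder P] (deg : P → ℕ) (K : ℕ → Set P) (n : ℕ) :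
    AddCommGrpCat.{u} :=
  AddCommGrpCat.of (MOn deg n (K n) ⧸ nonCriticalImage deg K n)

/-- The class in `B_n^K` of an element of `∏_{p ∈ K_n} F_n(p)`. -/
noncomputable def B.mk {P : Type u} [PartialOrder P] (deg : P → ℕ) (K : ℕ → Set P) (n : ℕ) :
    MOn deg n (K n) →+ B deg K n :=
  QuotientAddGroup.mk' (nonCriticalImage deg K n)

end PosetCohomology

open PosetCohomology

/-! The complex computes the higher limits by dimension shifting along `0 → F_n → Ker'_{F_n} →
F_{n+1} → 0`. Three facts carry the argument.

Local structure: for `deg p > n` the group `F_n(p)` is the product of the `F_n(q)` with `q ∈ J_n^p`,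
and every `F_n(p)` is free of rank `R_n^p` (`IsAdequate.isDetectedBy_and_hasRank`). Hence `λ_n` is
injective and the sequences above are short exact.

Acyclicity: `Ker'_{F_n}` has no higher `Ext` from the constant functor (`ext_prodFunctor_eq_zero`).
So `H^{n+1}(P; ℤ)` is `Ext¹(ℤ, F_n)`, which is `lim F_{n+1}` modulo the image of `lim Ker'_{F_n} =
M_n`. Since `lim F_n` is the kernel of `d_n` in `M_n`, the complex `M` already has the right
cohomology.

Reduction to `K`: an element of `lim F_n` is determined by its values on `K_n`, and `d_n x` comes
from `lim F_{n+1}`, so vanishing of `d_n x` can be tested on `K_{n+1}`. The part of `M_n` off `K_n`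
therefore embeds in the part of `M_{n+1}` on `K_{n+1}`. Cancelling these two parts leaves `B^K` with
the same cohomology. Purity makes the quotients free, and the ranks follow by subtraction. -/

namespace PosetCohomology

/-! ### Normalised representatives and the rank of `F_{n+1}(p)` -/

section LocalStructure

variable {P : Type u} [PartialOrder P] {deg : P → ℕ}

theorem proj_surjective (n : ℕ) (p : P) : Function.Surjective (proj deg n p) :=
  QuotientAddGroup.mk'_surjective (G := (kerPrime deg n (F deg n)).obj p)
    ((diag deg n (F deg n)).app p).hom.range

theorem proj_eq_zero_iff (n : ℕ) (p : P) (x : ∀ q : above deg n p, (F deg n).obj q.1) :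
    proj deg n p x = 0 ↔
      ∃ y : (F deg n).obj p, ∀ q : above deg n p, (F deg n).map (homOfLE q.2.1) y = x q := by
  refine (QuotientAddGroup.eq_zero_iff (G := (kerPrime deg n (F deg n)).obj p)
    (N := ((diag deg n (F deg n)).app p).hom.range) x).trans ?_
  constructor
  · rintro ⟨y, hy⟩
    exact ⟨y, fun q => congrFun hy q⟩
  · rintro ⟨y, hy⟩
    exact ⟨y, funext hy⟩

theorem map_proj (n : ℕ) {p q : P} (h : p ≤ q)
    (x : ∀ r : above deg n p, (F deg n).obj r.1) :
    (F deg (n + 1)).map (homOfLE h) (proj deg n p x) =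
      proj deg n q (fun r => x ⟨r.1, h.trans r.2.1, r.2.2⟩) := rfl

theorem F_map_map (n : ℕ) {p q r : P} (h : p ≤ q) (h' : q ≤ r) (x : (F deg n).obj p) :
    (F deg n).map (homOfLE h') ((F deg n).map (homOfLE h) x) =
      (F deg n).map (homOfLE (h.trans h')) x := by
  rw [← ConcreteCategory.comp_apply, ← Functor.map_comp]
  rfl

theorem F_map_self (n : ℕ) {p : P} (h : p ≤ p) (x : (F deg n).obj p) :
    (F deg n).map (homOfLE h) x = x := by
  have : homOfLE h = 𝟙 p := rfl
  rw [this, CategoryTheory.Functor.map_id]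
  rfl

/-- A minimal element of the finite set of `r` with `p < r ≤ q` covers `p`, so the degree already
drops by one there. -/
theorem IsDegreeFunction.lt_of_lt (hdeg : IsDegreeFunction deg)
    (hfin : ∀ p₀ : P, {p : P | p₀ ≤ p}.Finite) {p q : P} (h : p < q) : deg q < deg p := by
  have hf : {r | p < r ∧ r ≤ q}.Finite := (hfin p).subset fun r hr => hr.1.le
  obtain ⟨r, hr⟩ := hf.exists_minimal ⟨q, h, le_rfl⟩
  have hcov : p ⋖ r := ⟨hr.1.1, fun s hs hs' =>
    hs'.not_ge (hr.2 ⟨hs, hs'.le.trans hr.1.2⟩ hs'.le)⟩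
  have h1 := hdeg.covBy p r hcov
  have h2 := hdeg.antitone hr.1.2
  omega

theorem IsDegreeFunction.eq_of_le (hdeg : IsDegreeFunction deg)
    (hfin : ∀ p₀ : P, {p : P | p₀ ≤ p}.Finite) {p q : P} (h : p ≤ q) (h' : deg q = deg p) :
    q = p := by
  rcases h.eq_or_lt with rfl | h
  · rfl
  · have := hdeg.lt_of_lt hfin h
    omega

theorem above_eq_empty (hdeg : IsDegreeFunction deg) {n : ℕ} {p : P} (h : deg p < n) :
    above deg n p = ∅ := by
  ext q
  simp only [above, Set.mem_ofPred_eq, Set.mem_empty_iff_false, iff_false, not_and]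
  intro hq
  have := hdeg.antitone hq
  omega

theorem above_deg_self (hdeg : IsDegreeFunction deg)
    (hfin : ∀ p₀ : P, {p : P | p₀ ≤ p}.Finite) (p : P) : above deg (deg p) p = {p} := by
  ext q
  constructor
  · rintro ⟨h, h'⟩
    exact hdeg.eq_of_le hfin h h'
  · rintro rfl
    exact ⟨le_rfl, rfl⟩

theorem finite_above (hfin : ∀ p₀ : P, {p : P | p₀ ≤ p}.Finite) (n : ℕ) (p : P) :
    (above deg n p).Finite :=
  (hfin p).subset fun _ h => h.1

/-- The functor `F_n` vanishes on objects of degree less than `n`. -/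
theorem subsingleton_F (hdeg : IsDegreeFunction deg)
    (hfin : ∀ p₀ : P, {p : P | p₀ ≤ p}.Finite) {n : ℕ} {p : P} (h : deg p < n) :
    Subsingleton ((F deg n).obj p) := by
  obtain _ | n := n
  · omega
  refine subsingleton_of_forall_eq 0 fun x => ?_
  obtain ⟨x, rfl⟩ := proj_surjective n p x
  rw [proj_eq_zero_iff]
  rcases Nat.lt_succ_iff_lt_or_eq.1 h with h | h
  · exact ⟨0, fun q => absurd (above_eq_empty hdeg h ▸ q.2 : q.1 ∈ (∅ : Set P)) (by simp)⟩
  -- Here `p` itself is the only object of degree `n` above `p`, so `λ_n` is an isomorphism at `p`.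
  · refine ⟨x ⟨p, le_rfl, h⟩, fun q => ?_⟩
    obtain ⟨q, hq⟩ := q
    obtain rfl : q = p := hdeg.eq_of_le hfin hq.1 (hq.2.trans h.symm)
    exact F_map_self n _ _

theorem R_eq_zero (hdeg : IsDegreeFunction deg)
    (hfin : ∀ p₀ : P, {p : P | p₀ ≤ p}.Finite) {n : ℕ} {p : P} (h : deg p < n) :
    R deg n p = 0 := by
  induction n with
  | zero => omega
  | succ n ih =>
    rw [R]
    rcases Nat.lt_succ_iff_lt_or_eq.1 h with h | rfl
    · rw [above_eq_empty hdeg h, ih h]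
      simp
    · rw [above_deg_self hdeg hfin]
      simp

/-- The natural map from `F_n(p)` to the product of the groups `F_n(q)` with `q ∈ S` is
bijective. -/
structure IsDetectedBy (deg : P → ℕ) (n : ℕ) (p : P) (S : Set P) : Prop where
  eq_zero : ∀ x : (F deg n).obj p,
    (∀ q ∈ S, ∀ h : p ≤ q, (F deg n).map (homOfLE h) x = 0) → x = 0
  exists_lift : ∀ y : ∀ q, (F deg n).obj q,
    ∃ x : (F deg n).obj p, ∀ q ∈ S, ∀ h : p ≤ q, (F deg n).map (homOfLE h) x = y q

/-- The group `F_n(p)` is free of rank `R_n^p`. -/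
structure HasRank (deg : P → ℕ) (n : ℕ) (p : P) : Prop where
  free : Module.Free ℤ ((F deg n).obj p)
  finite : Module.Finite ℤ ((F deg n).obj p)
  finrank_eq : (Module.finrank ℤ ((F deg n).obj p) : ℤ) = R deg n p

/-- Every class in `F_{n+1}(p)` has a unique representative vanishing on `S`, when `F_n(p)` is
detected by `S`. -/
theorem IsDetectedBy.exists_representative {n : ℕ} {p : P} {S : Set P}
    (hS : IsDetectedBy deg n p S) (x : (F deg (n + 1)).obj p) :
    ∃ y : ∀ q : above deg n p, (F deg n).obj q.1,
      (∀ q : above deg n p, q.1 ∈ S → y q = 0) ∧ proj deg n p y = x := by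
  classical
  obtain ⟨x, rfl⟩ := proj_surjective n p x
  -- `z` agrees with `x` on `S`; subtracting its diagonal image does not change the class. The value
  -- `0` is a filler for objects outside the index set.
  obtain ⟨z, hz⟩ := hS.exists_lift fun q => if h : q ∈ above deg n p then x ⟨q, h⟩ else 0
  let w : ∀ q : above deg n p, (F deg n).obj q.1 := fun q => (F deg n).map (homOfLE q.2.1) z
  refine ⟨x - w, fun q hq => ?_, ?_⟩
  · have := hz q.1 hq q.2.1
    rw [dif_pos q.2] at this
    change x q - (F deg n).map (homOfLE q.2.1) z = 0
    rw [this, sub_self]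
  · have : proj deg n p w = 0 := (proj_eq_zero_iff n p w).2 ⟨z, fun q => rfl⟩
    rw [map_sub, this, sub_zero]

theorem IsDetectedBy.eq_zero_of_proj_eq_zero {n : ℕ} {p : P} {S : Set P}
    (hS : IsDetectedBy deg n p S) (hSa : S ⊆ above deg n p)
    (x : ∀ q : above deg n p, (F deg n).obj q.1)
    (hx : ∀ q : above deg n p, q.1 ∈ S → x q = 0) (h : proj deg n p x = 0) : x = 0 := by
  obtain ⟨y, hy⟩ := (proj_eq_zero_iff n p x).1 h
  have : y = 0 := hS.eq_zero y fun q hq hpq => (hy ⟨q, hSa hq⟩).trans (hx _ hq)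
  funext q
  rw [← hy q, this, map_zero]
  rfl

theorem hasRank_zero (p : P) : HasRank deg 0 p := by
  have e' : ((F deg 0).obj p) ≃ₗ[ℤ] ℤ := (AddEquiv.ulift : ULift.{u} ℤ ≃+ ℤ).toIntLinearEquiv
  exact ⟨Module.Free.of_equiv e'.symm, Module.Finite.equiv e'.symm, by
    rw [e'.finrank_eq]; simp [R]⟩

theorem isDetectedBy_zero {p : P} {S : Set P} (hS : ∃ q, S = {q}) (hle : ∀ q ∈ S, p ≤ q) :
    IsDetectedBy deg 0 p S := by
  obtain ⟨q, rfl⟩ := hS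
  exact ⟨fun x hx => hx q rfl (hle q rfl), fun y => ⟨y q, by rintro _ rfl h; rfl⟩⟩

theorem finsum_mem_coe_finrank {ι : Type*} (S : Set ι) (hS : S.Finite) (G : ι → Type*)
    [∀ i, AddCommGroup (G i)] [∀ i, Module.Free ℤ (G i)] [∀ i, Module.Finite ℤ (G i)] :
    (Module.finrank ℤ (∀ i : S, G i) : ℤ) = ∑ᶠ i ∈ S, (Module.finrank ℤ (G i) : ℤ) := by
  have := hS.fintype
  rw [Module.finrank_pi_fintype, finsum_mem_eq_finite_toFinset_sum _ hS, Nat.cast_sum]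
  exact (Finset.sum_subtype hS.toFinset (by simp)
    (fun i => (Module.finrank ℤ (G i) : ℤ))).symm

/-- Representatives vanishing on `S` identify `F_{n+1}(p)` with the product of `F_n(q)` over the
remaining `q`. By `hR` the omitted factors have total rank `R_n^p`, which is exactly the term
subtracted in the recursion for `R`. -/
theorem IsDetectedBy.hasRank_succ (hfin : ∀ p₀ : P, {p : P | p₀ ≤ p}.Finite) {n : ℕ} {p : P}
    {S : Set P} (hS : IsDetectedBy deg n p S) (hSa : S ⊆ above deg n p)
    (hrank : ∀ q, HasRank deg n q) (hR : R deg n p = ∑ᶠ q ∈ S, R deg n q) :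
    HasRank deg (n + 1) p := by
  classical
  have hfree := fun q => (hrank q).free
  have hfinite := fun q => (hrank q).finite
  have hT : (above deg n p \ S).Finite := (finite_above hfin n p).sdiff
  have := hT.to_subtype
  let ext : (∀ q : ↥(above deg n p \ S), (F deg n).obj q.1) →+
      (∀ q : above deg n p, (F deg n).obj q.1) :=
    { toFun := fun x q => if h : q.1 ∈ S then 0 else x ⟨q.1, q.2, h⟩
      map_zero' := by funext q; by_cases h : q.1 ∈ S <;> simp [h]
      map_add' := fun x y => by funext q; by_cases h : q.1 ∈ S <;> simp [h] }
  have hbij : Function.Bijective ((proj deg n p).comp ext) := by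
    constructor
    · rw [injective_iff_map_eq_zero]
      intro x hx
      have h0 : ext x = 0 := hS.eq_zero_of_proj_eq_zero hSa _ (fun q hq => dif_pos hq) hx
      funext q
      have := congrFun h0 ⟨q.1, q.2.1⟩
      exact (dif_neg q.2.2).symm.trans this
    · intro x
      obtain ⟨y, hy, rfl⟩ := hS.exists_representative x
      refine ⟨fun q => y ⟨q.1, q.2.1⟩, congrArg (proj deg n p) (funext fun q => ?_)⟩
      by_cases h : q.1 ∈ S
      · exact (dif_pos h).trans (hy q h).symm
      · exact dif_neg h
  have e : (∀ q : ↥(above deg n p \ S), (F deg n).obj q.1) ≃ₗ[ℤ] (F deg (n + 1)).obj p :=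
    (AddEquiv.ofBijective _ hbij).toIntLinearEquiv
  refine ⟨Module.Free.of_equiv e, Module.Finite.equiv e, ?_⟩
  have hsum : ∑ᶠ q ∈ above deg n p, R deg n q =
      ∑ᶠ q ∈ S, R deg n q + ∑ᶠ q ∈ above deg n p \ S, R deg n q := by
    rw [← finsum_mem_union Set.disjoint_sdiff_right ((finite_above hfin n p).subset hSa) hT,
      Set.union_sdiff_cancel hSa]
  rw [← e.finrank_eq, finsum_mem_coe_finrank _ hT (fun q => (F deg n).obj q), R, hsum, ← hR,
    add_sub_cancel_left]
  exact finsum_mem_congr rfl fun q _ => (hrank q).finrank_eq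

end LocalStructure

/-! ### Detection by the local covering family -/

section Detection

variable {P : Type u} [PartialOrder P] {deg : P → ℕ}

/-- An injective homomorphism between free groups of the same finite rank is surjective if its
cokernel is torsion-free. -/
theorem surjective_of_injective_of_saturated {A B : Type*} [AddCommGroup A] [AddCommGroup B]
    [Module.Free ℤ A] [Module.Finite ℤ A] [Module.Free ℤ B] [Module.Finite ℤ B]
    (f : A →+ B) (hf : Function.Injective f) (h : Module.finrank ℤ A = Module.finrank ℤ B)
    (hsat : ∀ (k : ℤ) (x : A) (b : B), k ≠ 0 → f x = k • b → ∃ x', x = k • x') :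
    Function.Surjective f := by
  intro b
  let g : A →ₗ[ℤ] B := f.toIntLinearMap
  -- Equal ranks make the cokernel torsion, and saturation then rules out nonzero torsion.
  have hq : Module.finrank ℤ (B ⧸ g.range) = 0 := by
    have h1 := Submodule.finrank_quotient_add_finrank g.range
    have h2 := LinearMap.finrank_range_of_inj (f := g) hf
    omega
  have htors := (Module.finrank_eq_zero_iff_isTorsion (R := ℤ) (M := B ⧸ g.range)).1 hq
  obtain ⟨⟨k, hk⟩, hkb⟩ := @htors (Submodule.Quotient.mk b)
  have hk0 : k ≠ 0 := nonZeroDivisors.ne_zero hk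
  have hkb' : (Submodule.Quotient.mk (k • b) : B ⧸ g.range) = 0 := hkb
  rw [Submodule.Quotient.mk_eq_zero] at hkb'
  obtain ⟨x, hx⟩ := hkb'
  obtain ⟨x', rfl⟩ := hsat k x b hk0 hx
  refine ⟨x', ?_⟩
  have h3 : k • f x' = k • b := by rw [← map_zsmul]; exact hx
  exact smul_right_injective B hk0 h3

/-- Detection passes from `F_n` to `F_{n+1}` along a covering. -/
theorem IsDetectedBy.succ (hfin : ∀ p₀ : P, {p : P | p₀ ≤ p}.Finite) {n : ℕ} {p : P}
    {S T : Set P} (hS : IsDetectedBy deg n p S)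
    (S' : P → Set P) (hS' : ∀ q ∈ T, IsDetectedBy deg n q (S' q))
    (hS'a : ∀ q ∈ T, S' q ⊆ above deg n q) (hmono : ∀ q ∈ T, S' q ⊆ S)
    (hT : T ⊆ above deg (n + 1) p) (hcover : above deg n p ⊆ ⋃ q ∈ T, above deg n q)
    (hrank : ∀ q, HasRank deg (n + 1) q)
    (hR : R deg (n + 1) p = ∑ᶠ q ∈ T, R deg (n + 1) q) :
    IsDetectedBy deg (n + 1) p T := by
  classical
  -- One divisibility statement serves twice: `k = 0` gives injectivity, `k ≠ 0` gives saturation.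
  -- By `hmono`, a representative vanishing on `S` restricts over each `q ∈ T` to one vanishing on
  -- `S' q`. Uniqueness of these makes its coordinates multiples of `k`, and the covering condition
  -- reaches every coordinate.
  have divisible : ∀ (k : ℤ) (x : (F deg (n + 1)).obj p),
      (∀ q ∈ T, ∀ h : p ≤ q, ∃ z, (F deg (n + 1)).map (homOfLE h) x = k • z) →
      ∃ z, x = k • z := by
    intro k x hx
    obtain ⟨y, hy, rfl⟩ := hS.exists_representative x
    have hdiv : ∀ r : above deg n p, ∃ w, y r = k • w := by
      rintro ⟨r, hr⟩
      obtain ⟨q, hq, hqr⟩ := Set.mem_iUnion₂.1 (hcover hr)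
      obtain ⟨z, hz⟩ := hx q hq (hT hq).1
      obtain ⟨w, hw, rfl⟩ := (hS' q hq).exists_representative z
      rw [map_proj, ← map_zsmul, ← sub_eq_zero, ← map_sub] at hz
      have h0 := (hS' q hq).eq_zero_of_proj_eq_zero (hS'a q hq) _ (fun s hs => by
        change y ⟨s.1, _⟩ - k • w s = 0
        rw [hy _ (hmono q hq hs), hw s hs, smul_zero, sub_zero]) hz
      exact ⟨w ⟨r, hqr⟩, sub_eq_zero.1 (congrFun h0 ⟨r, hqr⟩)⟩
    choose w hw using hdiv
    refine ⟨proj deg n p w, ?_⟩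
    rw [← map_zsmul]
    exact congrArg _ (funext hw)
  have eq_zero : ∀ x : (F deg (n + 1)).obj p,
      (∀ q ∈ T, ∀ h : p ≤ q, (F deg (n + 1)).map (homOfLE h) x = 0) → x = 0 := by
    intro x hx
    obtain ⟨z, hz⟩ := divisible 0 x fun q hq h => ⟨0, by rw [hx q hq h, smul_zero]⟩
    rw [hz, zero_smul]
  refine ⟨eq_zero, fun y => ?_⟩
  have hfree' := fun q => (hrank q).free
  have hfinite' := fun q => (hrank q).finite
  have hTf : T.Finite := (finite_above hfin _ p).subset hT
  have := hTf.to_subtype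
  let f : (F deg (n + 1)).obj p →+ (∀ q : T, (F deg (n + 1)).obj q.1) :=
    { toFun := fun x q => (F deg (n + 1)).map (homOfLE (hT q.2).1) x
      map_zero' := by funext q; simp
      map_add' := fun x y => by funext q; simp }
  have hsurj := surjective_of_injective_of_saturated f
    ((injective_iff_map_eq_zero f).2 fun x hx => eq_zero x fun q hq _ => congrFun hx ⟨q, hq⟩)
    (by
      have h1 := finsum_mem_coe_finrank T hTf fun q => (F deg (n + 1)).obj q
      rw [finsum_mem_congr rfl fun q _ => (hrank q).finrank_eq, ← hR, ← (hrank p).finrank_eq] at h1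
      exact_mod_cast h1.symm)
    (fun k x b _ h => divisible k x fun q hq _ => ⟨b ⟨q, hq⟩, congrFun h ⟨q, hq⟩⟩)
  obtain ⟨x, hx⟩ := hsurj fun q => y q.1
  exact ⟨x, fun q hq _ => congrFun hx ⟨q, hq⟩⟩

theorem HasRank.of_deg_lt (hdeg : IsDegreeFunction deg)
    (hfin : ∀ p₀ : P, {p : P | p₀ ≤ p}.Finite) {n : ℕ} {p : P} (h : deg p < n) :
    HasRank deg n p := by
  have := subsingleton_F hdeg hfin h
  refine ⟨inferInstance, inferInstance, ?_⟩
  rw [R_eq_zero hdeg hfin h, Module.finrank_zero_of_subsingleton, Nat.cast_zero]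

/-- The two claims need each other: ranks in stage `n + 1` use detection in stage `n`, while
detection in stage `n + 1` uses the ranks there to turn an injection into an isomorphism. -/
theorem IsAdequate.isDetectedBy_and_hasRank (hdeg : IsDegreeFunction deg)
    (hfin : ∀ p₀ : P, {p : P | p₀ ≤ p}.Finite) {J : P → ℕ → Set P} (hJ : IsAdequate deg J)
    (n : ℕ) :
    (∀ p, n < deg p → IsDetectedBy deg n p (J p n)) ∧ ∀ p, HasRank deg n p := by
  induction n with
  | zero =>
    refine ⟨fun p hp => isDetectedBy_zero ?_ fun q hq => (hJ.subset p 0 hp.le hq).1, hasRank_zero⟩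
    -- As `R_0` is constantly `1`, this equation says that `J p 0` has exactly one element.
    have h := hJ.rank_eq 0 p hp
    have hf : (J p 0).Finite := (finite_above hfin 0 p).subset (hJ.subset p 0 hp.le)
    simp only [R] at h
    rw [finsum_mem_eq_finite_toFinset_sum _ hf, Finset.sum_const, nsmul_eq_mul, mul_one,
      ← Set.ncard_eq_toFinset_card _ hf] at h
    exact Set.ncard_eq_one.1 (by exact_mod_cast h.symm)
  | succ n ih =>
    obtain ⟨ihd, ihr⟩ := ih
    have hrank : ∀ p, HasRank deg (n + 1) p := by
      intro p
      by_cases hp : n < deg p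
      · exact (ihd p hp).hasRank_succ hfin (hJ.subset p n hp.le) ihr (hJ.rank_eq n p hp)
      · exact .of_deg_lt hdeg hfin (by omega)
    refine ⟨fun p hp => ?_, hrank⟩
    have hsub := hJ.subset p (n + 1) hp.le
    refine (ihd p (by omega)).succ hfin (fun q => J q n)
      (fun q hq => ihd q ?_) (fun q hq => hJ.subset q n ?_)
      (fun q hq => hJ.mono p n (by omega) q hq) hsub (hJ.cover p n (by omega)).ge hrank
      (hJ.rank_eq (n + 1) p hp)
    all_goals have := (hsub hq).2; omega

/-- The transformation `λ_n` is injective. -/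
theorem IsAdequate.eq_zero_of_map_eq_zero (hdeg : IsDegreeFunction deg)
    (hfin : ∀ p₀ : P, {p : P | p₀ ≤ p}.Finite) {J : P → ℕ → Set P} (hJ : IsAdequate deg J)
    {n : ℕ} {p : P} (x : (F deg n).obj p)
    (hx : ∀ q (h : q ∈ above deg n p), (F deg n).map (homOfLE h.1) x = 0) : x = 0 := by
  rcases lt_trichotomy (deg p) n with h | h | h
  · have := subsingleton_F hdeg hfin h
    exact Subsingleton.elim _ _
  · rw [← F_map_self n le_rfl x]
    exact hx p ⟨le_rfl, h⟩
  · exact ((hJ.isDetectedBy_and_hasRank hdeg hfin n).1 p h).eq_zero x fun q hq _ =>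
      hx q (hJ.subset p n h.le hq)

end Detection

/-! ### Acyclicity of the product functors -/

section Acyclic

variable {P : Type u} [PartialOrder P] {deg : P → ℕ}

instance : HasExt.{u} (P ⥤ AddCommGrpCat.{u}) := CategoryTheory.hasExt_of_enoughInjectives _

/-- A sequence of functors is short exact if it is so object-wise. -/
theorem shortExact_of_app {F₁ F₂ F₃ : P ⥤ AddCommGrpCat.{u}} (f : F₁ ⟶ F₂) (g : F₂ ⟶ F₃)
    (hf : ∀ p, Function.Injective (f.app p)) (hg : ∀ p, Function.Surjective (g.app p))
    (hfg : ∀ p x, g.app p x = 0 ↔ ∃ y, f.app p y = x) :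
    ∃ w : f ≫ g = 0, (ShortComplex.mk f g w).ShortExact := by
  have w : f ≫ g = 0 := by
    ext p x
    exact (hfg p _).2 ⟨x, rfl⟩
  have : ∀ p, Mono (f.app p) := fun p => (AddCommGrpCat.mono_iff_injective _).2 (hf p)
  have : ∀ p, Epi (g.app p) := fun p => (AddCommGrpCat.epi_iff_surjective _).2 (hg p)
  have hexact : (ShortComplex.mk f g w).Exact := by
    rw [ShortComplex.exact_iff_isZero_homology, Functor.isZero_iff]
    intro p
    refine IsZero.of_iso ?_
      ((ShortComplex.mk f g w).mapHomologyIso ((evaluation P AddCommGrpCat.{u}).obj p)).symm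
    rw [← ShortComplex.exact_iff_isZero_homology, ShortComplex.ab_exact_iff]
    exact fun x hx => (hfg p x).1 hx
  exact ⟨w, ShortComplex.ShortExact.mk' hexact (NatTrans.mono_of_mono_app _)
    (NatTrans.epi_of_epi_app _)⟩

/-- The functor `p ↦ ∏_{q ≥ p, deg q = n} G q`, whose maps are the projections. -/
def prodFunctor (deg : P → ℕ) (n : ℕ) (G : P → AddCommGrpCat.{u}) : P ⥤ AddCommGrpCat.{u} where
  obj p := AddCommGrpCat.of (∀ q : above deg n p, G q.1)
  map {p₁ _} f := AddCommGrpCat.ofHom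
    { toFun := fun x q => (x : ∀ q : above deg n p₁, G q.1) ⟨q.1, f.le.trans q.2.1, q.2.2⟩
      map_zero' := rfl
      map_add' := fun _ _ => rfl }

/-- The functor `prodFunctor` on morphisms. -/
def prodFunctorMap (deg : P → ℕ) (n : ℕ) {G H : P → AddCommGrpCat.{u}} (f : ∀ p, G p ⟶ H p) :
    prodFunctor deg n G ⟶ prodFunctor deg n H where
  app p := AddCommGrpCat.ofHom
    { toFun := fun x q => f q.1 ((x : ∀ q : above deg n p, G q.1) q)
      map_zero' := by funext q; simp
      map_add' := fun x y => by funext q; simp }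

/-- A morphism to `prodFunctor` given by its components at the objects of degree `n`. -/
def prodFunctorLift (n : ℕ) {G : P → AddCommGrpCat.{u}} {X : P ⥤ AddCommGrpCat.{u}}
    (f : ∀ p, deg p = n → (X.obj p ⟶ G p)) : X ⟶ prodFunctor deg n G where
  app p := AddCommGrpCat.ofHom
    { toFun := fun x q => f q.1 q.2.2 (X.map (homOfLE q.2.1) x)
      map_zero' := by funext q; simp
      map_add' := fun x y => by funext q; simp }
  naturality p₁ p₂ h := by
    ext x
    funext q
    change f q.1 q.2.2 (X.map (homOfLE q.2.1) (X.map h x)) =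
      f q.1 q.2.2 (X.map (homOfLE (h.le.trans q.2.1)) x)
    rw [← ConcreteCategory.comp_apply (X.map h), ← X.map_comp]
    rfl

/-- A morphism into `prodFunctor` is a choice of components at the objects of degree `n`, with no
compatibility between them. So it extends as soon as each component does. -/
instance injective_prodFunctor (n : ℕ) (G : P → AddCommGrpCat.{u}) [∀ p, Injective (G p)] :
    Injective (prodFunctor deg n G) where
  factors {X Y} g f _ := by
    let ev : ∀ p (h : deg p = n), (prodFunctor deg n G).obj p ⟶ G p := fun p h =>
      AddCommGrpCat.ofHom
        { toFun := fun x => (x : ∀ q : above deg n p, G q.1) ⟨p, le_rfl, h⟩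
          map_zero' := rfl
          map_add' := fun _ _ => rfl }
    refine ⟨prodFunctorLift n fun p h => Injective.factorThru (g.app p ≫ ev p h) (f.app p), ?_⟩
    ext p x
    funext q
    change Injective.factorThru (g.app q.1 ≫ ev q.1 q.2.2) (f.app q.1)
      (Y.map (homOfLE q.2.1) (f.app p x)) = (g.app p x : ∀ q : above deg n p, G q.1) q
    rw [← ConcreteCategory.comp_apply (f.app p), ← f.naturality, ConcreteCategory.comp_apply,
      ← ConcreteCategory.comp_apply (f.app q.1), Injective.comp_factorThru,
      ConcreteCategory.comp_apply, ← ConcreteCategory.comp_apply (X.map _), g.naturality]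
    rfl

/-- A morphism from the constant functor `ℤ`, given by a compatible family of elements. -/
noncomputable def fromConstZ (X : P ⥤ AddCommGrpCat.{u}) (x : ∀ p, X.obj p)
    (hx : ∀ p q (h : p ≤ q), X.map (homOfLE h) (x p) = x q) : constZ P ⟶ X where
  app p := AddCommGrpCat.ofHom
    { toFun := fun k => (k : ULift.{u} ℤ).down • x p
      map_zero' := zero_smul _ _
      map_add' := fun _ _ => add_smul _ _ _ }
  naturality p q h := by
    ext k
    change (k : ULift.{u} ℤ).down • x q = X.map h ((k : ULift.{u} ℤ).down • x p)
    rw [map_zsmul, ← hx p q h.le]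
    rfl

/-- The generator of `ℤ`. -/
def oneZ (p : P) : (constZ P).obj p := (ULift.up 1 : ULift.{u} ℤ)

theorem fromConstZ_app_one (X : P ⥤ AddCommGrpCat.{u}) (x : ∀ p, X.obj p)
    (hx : ∀ p q (h : p ≤ q), X.map (homOfLE h) (x p) = x q) (p : P) :
    (fromConstZ X x hx).app p (oneZ p) = x p := one_smul ℤ (x p)

theorem map_app_one {X : P ⥤ AddCommGrpCat.{u}} (f : constZ P ⟶ X) {p q : P} (h : p ⟶ q) :
    X.map h (f.app p (oneZ p)) = f.app q (oneZ q) := by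
  rw [← ConcreteCategory.comp_apply, ← f.naturality]
  rfl

theorem hom_constZ_ext {X : P ⥤ AddCommGrpCat.{u}} {f g : constZ P ⟶ X}
    (h : ∀ p, f.app p (oneZ p) = g.app p (oneZ p)) : f = g := by
  ext p k
  have hk : k = (k : ULift.{u} ℤ).down • oneZ p := by
    apply ULift.ext
    change _ = (k : ULift.{u} ℤ).down • (1 : ℤ)
    simp
  rw [hk, map_zsmul, map_zsmul, h p]

/-- A morphism from the constant functor to `prodFunctor`, given by its components. -/
noncomputable def constToProd (deg : P → ℕ) (n : ℕ) (G : P → AddCommGrpCat.{u})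
    (x : ∀ p : {p : P // deg p = n}, G p.1) : constZ P ⟶ prodFunctor deg n G :=
  fromConstZ _ (fun _ (q : above deg n _) => x ⟨q.1, q.2.2⟩) fun _ _ _ => rfl

theorem constToProd_app_one (n : ℕ) (G : P → AddCommGrpCat.{u})
    (x : ∀ p : {p : P // deg p = n}, G p.1) (p : P) (q : above deg n p) :
    ((constToProd deg n G x).app p (oneZ p) : ∀ q : above deg n p, G q.1) q = x ⟨q.1, q.2.2⟩ :=
  congrFun (fromConstZ_app_one (prodFunctor deg n G) _ _ p) q

theorem eq_constToProd (n : ℕ) {G : P → AddCommGrpCat.{u}} (f : constZ P ⟶ prodFunctor deg n G) :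
    f = constToProd deg n G fun p =>
      (f.app p.1 (oneZ p.1) : ∀ q : above deg n p.1, G q.1) ⟨p.1, le_rfl, p.2⟩ := by
  refine hom_constZ_ext fun p => funext fun q => ?_
  refine Eq.trans ?_ (constToProd_app_one n G _ p q).symm
  exact congrFun (map_app_one f (homOfLE q.2.1)) ⟨q.1, le_rfl, q.2.2⟩

/-- The functors `prodFunctor` are acyclic for the inverse limit. -/
theorem ext_prodFunctor_eq_zero (n i : ℕ) (G : P → AddCommGrpCat.{u})
    (e : Abelian.Ext.{u} (constZ P) (prodFunctor deg n G) (i + 1)) : e = 0 := by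
  induction i using Nat.strong_induction_on generalizing G with
  | _ i ih =>
    -- Embedding each `G p` in an injective `D p` with quotient `Q p` gives a short exact sequence
    -- of product functors with injective middle term, so the degree of `e` drops by one.
    let D : P → AddCommGrpCat.{u} := fun p => Injective.under (G p)
    let Q : P → AddCommGrpCat.{u} := fun p => AddCommGrpCat.of (D p ⧸ (Injective.ι (G p)).hom.range)
    let π : ∀ p, D p ⟶ Q p := fun p =>
      AddCommGrpCat.ofHom (QuotientAddGroup.mk' (Injective.ι (G p)).hom.range)
    have hπ : ∀ p, Function.Surjective (π p) := fun p => QuotientAddGroup.mk'_surjective _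
    obtain ⟨w, hS⟩ := shortExact_of_app (prodFunctorMap deg n fun p => Injective.ι (G p))
      (prodFunctorMap deg n π)
      (fun p x y hxy => funext fun q =>
        (AddCommGrpCat.mono_iff_injective (Injective.ι (G q.1))).1 inferInstance
          (congrFun hxy q))
      (fun p y => by
        choose x hx using fun q : above deg n p => hπ q.1 (y q)
        exact ⟨x, funext hx⟩)
      (fun p x => by
        constructor
        · intro hx
          have : ∀ q : above deg n p, ∃ y, Injective.ι (G q.1) y = x q := fun q =>
            (QuotientAddGroup.eq_zero_iff (N := (Injective.ι (G q.1)).hom.range) (x q)).1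
              (congrFun hx q)
          choose y hy using this
          exact ⟨y, funext hy⟩
        · rintro ⟨y, rfl⟩
          exact funext fun q => (QuotientAddGroup.eq_zero_iff _).2 ⟨y q, rfl⟩)
    obtain ⟨x₃, rfl⟩ := Abelian.Ext.covariant_sequence_exact₁ _ hS e
      (Abelian.Ext.eq_zero_of_injective _) rfl
    cases i with
    | succ i => rw [ih i (Nat.lt_succ_self i) Q x₃, Abelian.Ext.zero_comp]
    | zero =>
      obtain ⟨f, rfl⟩ := Abelian.Ext.addEquiv₀.symm.surjective x₃
      -- In the base case, a morphism from the constant functor to the product of the `Q p` is an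
      -- arbitrary family of elements, hence lifts to the `D p`; its connecting class is zero.
      choose y hy using fun p : {p : P // deg p = n} => hπ p.1
        ((f.app p.1 (oneZ p.1) : ∀ q : above deg n p.1, Q q.1) ⟨p.1, le_rfl, p.2⟩)
      have hf : constToProd deg n D y ≫ prodFunctorMap deg n π = f := by
        rw [eq_constToProd n f]
        refine hom_constZ_ext fun p => funext fun q => ?_
        refine Eq.trans ?_ (constToProd_app_one n Q _ p q).symm
        refine Eq.trans ?_ (hy ⟨q.1, q.2.2⟩)
        exact congrArg (π q.1) (constToProd_app_one n D y p q)
      rw [Abelian.Ext.addEquiv₀_symm_apply, ← hf, ← Abelian.Ext.mk₀_comp_mk₀,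
        Abelian.Ext.comp_assoc_of_second_deg_zero, hS.comp_extClass, Abelian.Ext.comp_zero]

end Acyclic

/-! ### Higher limits as `Ext` groups and dimension shifting -/

section Comparison

/-- The homology of a cochain complex of abelian groups is determined by a group `G` of cocycles
which represents all classes, and a surjection from `G` whose kernel consists of the
coboundaries. -/
theorem homology_addEquiv (K : CochainComplex AddCommGrpCat.{u} ℕ) {i n : ℕ}
    (hi : (ComplexShape.up ℕ).prev n = i) {G A : Type u} [AddCommGroup G] [AddCommGroup A]
    (z : G →+ K.X n) (hz : ∀ g, K.d n (n + 1) (z g) = 0)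
    (hz' : ∀ x, K.d n (n + 1) x = 0 → ∃ g y, x = z g + K.d i n y)
    (a : G →+ A) (hsurj : Function.Surjective a) (ha : ∀ g, a g = 0 ↔ ∃ y, K.d i n y = z g) :
    Nonempty (K.homology n ≃+ A) := by
  let S := K.sc' i n (n + 1)
  have e : K.homology n ≃+ (AddMonoidHom.ker S.g.hom ⧸ S.abToCycles.range) :=
    (K.homologyIsoSc' i n (n + 1) hi (by simp) ≪≫ S.abHomologyIso).addCommGroupIsoToAddEquiv
  let b : G →+ (AddMonoidHom.ker S.g.hom ⧸ S.abToCycles.range) :=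
    (QuotientAddGroup.mk' _).comp (z.codRestrict (AddMonoidHom.ker S.g.hom) hz)
  have hb : Function.Surjective b := by
    intro x
    obtain ⟨⟨x, hx⟩, rfl⟩ := QuotientAddGroup.mk'_surjective _ x
    obtain ⟨g, y, hy⟩ := hz' x hx
    refine ⟨g, (QuotientAddGroup.eq).2 ⟨y, Subtype.ext ?_⟩⟩
    change K.d i n y = - z g + (show K.X n from x)
    exact (neg_add_eq_of_eq_add hy).symm
  have hker : a.ker = b.ker := by
    ext g
    rw [AddMonoidHom.mem_ker, AddMonoidHom.mem_ker, ha]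
    refine Iff.trans ?_ (QuotientAddGroup.eq_zero_iff _).symm
    exact ⟨fun ⟨y, hy⟩ => ⟨y, Subtype.ext hy⟩, fun ⟨y, hy⟩ => ⟨y, congrArg Subtype.val hy⟩⟩
  exact ⟨e.trans ((QuotientAddGroup.quotientKerEquivOfSurjective b hb).symm.trans
    ((QuotientAddGroup.quotientAddEquivOfEq hker.symm).trans
      (QuotientAddGroup.quotientKerEquivOfSurjective a hsurj)))⟩

variable {P : Type u} [PartialOrder P] {deg : P → ℕ}

/-- The generator of the inverse limit of the constant functor. -/
noncomputable def oneLim (P : Type u) [PartialOrder P] :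
    (lim.obj (constZ P) : AddCommGrpCat.{u}) :=
  limit.lift (constZ P) ⟨AddCommGrpCat.of (ULift.{u} ℤ), 𝟙 _⟩ (ULift.up 1 : ULift.{u} ℤ)

theorem limit_π_oneLim (p : P) : limit.π (constZ P) p (oneLim P) = oneZ p := by
  change limit.π (constZ P) p (limit.lift (constZ P) _ _) = _
  rw [← ConcreteCategory.comp_apply, limit.lift_π]
  rfl

/-- Evaluation of a morphism from the constant functor, with values in the inverse limit. -/
noncomputable def toLim (X : P ⥤ AddCommGrpCat.{u}) :
    (constZ P ⟶ X) →+ (lim.obj X : AddCommGrpCat.{u}) where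
  toFun f := lim.map f (oneLim P)
  map_zero' := by rw [Functor.map_zero]; rfl
  map_add' f g := by rw [Functor.map_add]; rfl

theorem limit_π_toLim {X : P ⥤ AddCommGrpCat.{u}} (f : constZ P ⟶ X) (p : P) :
    limit.π X p (toLim X f) = f.app p (oneZ p) := by
  change limit.π X p (lim.map f (oneLim P)) = _
  rw [← ConcreteCategory.comp_apply, lim_map, limMap_π, ConcreteCategory.comp_apply,
    limit_π_oneLim]

theorem toLim_comp {X Y : P ⥤ AddCommGrpCat.{u}} (f : constZ P ⟶ X) (g : X ⟶ Y) :
    toLim Y (f ≫ g) = lim.map g (toLim X f) := by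
  change lim.map (f ≫ g) (oneLim P) = _
  rw [Functor.map_comp, ConcreteCategory.comp_apply]
  rfl

theorem toLim_bijective (X : P ⥤ AddCommGrpCat.{u}) : Function.Bijective (toLim X) := by
  constructor
  · intro f g h
    refine hom_constZ_ext fun p => ?_
    rw [← limit_π_toLim, ← limit_π_toLim, h]
  · intro x
    refine ⟨fromConstZ X (fun p => limit.π X p x) fun p q h => ?_, ?_⟩
    · rw [← ConcreteCategory.comp_apply, limit.w]
    · refine Concrete.limit_ext X _ _ fun p => ?_
      rw [limit_π_toLim, fromConstZ_app_one]

/-- The higher limits are the groups `Extⁿ(ℤ, -)`. -/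
theorem rightDerived_lim_addEquiv_ext (X : P ⥤ AddCommGrpCat.{u}) (n : ℕ) :
    Nonempty (((lim : (P ⥤ AddCommGrpCat.{u}) ⥤ AddCommGrpCat.{u}).rightDerived (n + 1)).obj X ≃+
      Abelian.Ext.{u} (constZ P) X (n + 1)) := by
  -- One injective resolution computes both sides: `toLim` identifies morphisms from the constant
  -- functor into its terms with their limits, so cocycles and coboundaries correspond.
  let I : InjectiveResolution X := InjectiveResolution.of X
  let K := (lim.mapHomologicalComplex (ComplexShape.up ℕ)).obj I.cocomplex
  let cocycles : AddSubgroup (constZ P ⟶ I.cocomplex.X (n + 1)) :=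
    { carrier := {f | f ≫ I.cocomplex.d (n + 1) (n + 2) = 0}
      zero_mem' := zero_comp
      add_mem' := fun {f g} hf hg => by
        rw [Set.mem_ofPred_eq] at *
        rw [Preadditive.add_comp, hf, hg, add_zero]
      neg_mem' := fun {f} hf => by
        rw [Set.mem_ofPred_eq] at *
        rw [Preadditive.neg_comp, hf, neg_zero] }
  have hd : ∀ (i j : ℕ) (f : constZ P ⟶ I.cocomplex.X i),
      K.d i j (toLim _ f) = toLim _ (f ≫ I.cocomplex.d i j) := fun i j f =>
    (toLim_comp f (I.cocomplex.d i j)).symm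
  obtain ⟨e⟩ := homology_addEquiv K (i := n) (n := n + 1) (by simp)
    ((toLim (I.cocomplex.X (n + 1))).comp cocycles.subtype)
    (fun f => by
      refine (hd _ _ _).trans ?_
      exact (congrArg _ f.2).trans (map_zero (toLim _)))
    (fun x hx => by
      obtain ⟨f, rfl⟩ := (toLim_bijective _).2 x
      rw [hd] at hx
      refine ⟨⟨f, (toLim_bijective _).1 (hx.trans (map_zero _).symm)⟩, 0, ?_⟩
      exact ((congrArg _ (map_zero (K.d n (n + 1)).hom)).trans (add_zero _)).symm)
    (A := Abelian.Ext.{u} (constZ P) X (n + 1))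
    { toFun := fun f => I.extMk f.1 (n + 2) rfl f.2
      map_zero' := I.extMk_zero _ _
      map_add' := fun f g => (I.add_extMk _ _ _ _ _ _).symm }
    (fun x => by
      obtain ⟨f, hf, rfl⟩ := I.extMk_surjective x (n + 2) rfl
      exact ⟨⟨f, hf⟩, rfl⟩)
    (fun f => by
      refine (I.extMk_eq_zero_iff f.1 (n + 2) rfl f.2 n rfl).trans ⟨?_, ?_⟩
      · rintro ⟨g, hg⟩
        exact ⟨toLim _ g, (hd _ _ g).trans (congrArg _ hg)⟩
      · rintro ⟨y, hy⟩
        obtain ⟨g, rfl⟩ := (toLim_bijective _).2 y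
        rw [hd] at hy
        exact ⟨g, (toLim_bijective _).1 hy⟩)
  exact ⟨(I.isoRightDerivedObj lim (n + 1)).addCommGroupIsoToAddEquiv.trans e⟩

/-- The projection `Ker'_{F_n} → F_{n+1}`. -/
noncomputable def projHom (deg : P → ℕ) (n : ℕ) :
    prodFunctor deg n (F deg n).obj ⟶ F deg (n + 1) where
  app p := AddCommGrpCat.ofHom (proj deg n p)
  naturality p q h := by
    ext x
    exact (map_proj n h.le x).symm

/-- The diagonal `F_n → Ker'_{F_n}`. -/
noncomputable def diagHom (deg : P → ℕ) (n : ℕ) : F deg n ⟶ prodFunctor deg n (F deg n).obj :=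
  diag deg n (F deg n)

theorem IsAdequate.shortExact (hdeg : IsDegreeFunction deg)
    (hfin : ∀ p₀ : P, {p : P | p₀ ≤ p}.Finite) {J : P → ℕ → Set P} (hJ : IsAdequate deg J)
    (n : ℕ) : ∃ w : diagHom deg n ≫ projHom deg n = 0, (ShortComplex.mk _ _ w).ShortExact :=
  shortExact_of_app _ _
    (fun p => (injective_iff_map_eq_zero ((diag deg n (F deg n)).app p).hom).2 fun x hx =>
      hJ.eq_zero_of_map_eq_zero hdeg hfin x fun q hq => congrFun hx ⟨q, hq⟩)
    (fun p => proj_surjective n p)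
    (fun p x => (proj_eq_zero_iff n p x).trans
      ⟨fun ⟨y, hy⟩ => ⟨y, funext hy⟩, fun ⟨y, hy⟩ => ⟨y, fun q => congrFun hy q⟩⟩)

/-- The connecting map is bijective because the neighbouring terms of the long exact sequence are
positive `Ext` groups into an acyclic functor. -/
theorem IsAdequate.ext_addEquiv_succ (hdeg : IsDegreeFunction deg)
    (hfin : ∀ p₀ : P, {p : P | p₀ ≤ p}.Finite) {J : P → ℕ → Set P} (hJ : IsAdequate deg J)
    (n i : ℕ) : Nonempty (Abelian.Ext.{u} (constZ P) (F deg (n + 1)) (i + 1) ≃+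
      Abelian.Ext.{u} (constZ P) (F deg n) (i + 2)) := by
  obtain ⟨w, hS⟩ := hJ.shortExact hdeg hfin n
  refine ⟨AddEquiv.ofBijective (hS.extClass.postcomp (constZ P) rfl) ⟨?_, ?_⟩⟩
  · rw [injective_iff_map_eq_zero]
    intro x hx
    obtain ⟨y, rfl⟩ := Abelian.Ext.covariant_sequence_exact₃ _ hS x rfl hx
    rw [ext_prodFunctor_eq_zero n i _ y, Abelian.Ext.zero_comp]
  · exact fun x => Abelian.Ext.covariant_sequence_exact₁ _ hS x
      (ext_prodFunctor_eq_zero n _ _ _) rfl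

theorem IsAdequate.ext_addEquiv (hdeg : IsDegreeFunction deg)
    (hfin : ∀ p₀ : P, {p : P | p₀ ≤ p}.Finite) {J : P → ℕ → Set P} (hJ : IsAdequate deg J)
    (n i m : ℕ) (hm : i + n = m) : Nonempty (Abelian.Ext.{u} (constZ P) (F deg n) (i + 1) ≃+
      Abelian.Ext.{u} (constZ P) (constZ P) (m + 1)) := by
  induction n generalizing i with
  | zero =>
    obtain rfl : i = m := hm
    exact ⟨AddEquiv.refl _⟩
  | succ n ih =>
    obtain ⟨e⟩ := hJ.ext_addEquiv_succ hdeg hfin n i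
    obtain ⟨e'⟩ := ih (i + 1) (by omega)
    exact ⟨e.trans e'⟩

/-- Evaluation of a morphism `ℤ → F_n` at the objects of degree `n`. -/
noncomputable def evalHom (deg : P → ℕ) (n : ℕ) : (constZ P ⟶ F deg n) →+ M deg n where
  toFun f p := f.app p.1 (oneZ p.1)
  map_zero' := rfl
  map_add' _ _ := rfl

theorem IsAdequate.evalHom_injective (hdeg : IsDegreeFunction deg)
    (hfin : ∀ p₀ : P, {p : P | p₀ ≤ p}.Finite) {J : P → ℕ → Set P} (hJ : IsAdequate deg J)
    (n : ℕ) : Function.Injective (evalHom deg n) := by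
  rw [injective_iff_map_eq_zero]
  intro f hf
  refine hom_constZ_ext fun p => ?_
  refine hJ.eq_zero_of_map_eq_zero hdeg hfin _ fun q hq => ?_
  rw [map_app_one]
  exact congrFun hf ⟨q, hq.2⟩

theorem IsAdequate.forall_proj_eq_zero_iff (hdeg : IsDegreeFunction deg)
    (hfin : ∀ p₀ : P, {p : P | p₀ ≤ p}.Finite) {J : P → ℕ → Set P} (hJ : IsAdequate deg J)
    (n : ℕ) (x : M deg n) :
    (∀ p, proj deg n p (fun q => x ⟨q.1, q.2.2⟩) = 0) ↔ ∃ f, evalHom deg n f = x := by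
  constructor
  · intro h
    choose y hy using fun p => (proj_eq_zero_iff n p _).1 (h p)
    -- Each `y p` is unique because `λ_n` is injective, and uniqueness forces compatibility.
    have hcomp : ∀ p q (hpq : p ≤ q), (F deg n).map (homOfLE hpq) (y p) = y q := by
      intro p q hpq
      rw [← sub_eq_zero]
      refine hJ.eq_zero_of_map_eq_zero hdeg hfin _ fun r hr => ?_
      rw [map_sub, F_map_map, hy q ⟨r, hr⟩, hy p ⟨r, hpq.trans hr.1, hr.2⟩, sub_self]
    · refine ⟨fromConstZ _ y hcomp, funext fun p => ?_⟩
      change (fromConstZ _ y hcomp).app p.1 (oneZ p.1) = x p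
      rw [fromConstZ_app_one, ← F_map_self n le_rfl (y p.1)]
      exact hy p.1 ⟨p.1, le_rfl, p.2⟩
  · rintro ⟨f, rfl⟩ p
    exact (proj_eq_zero_iff n p _).2 ⟨f.app p (oneZ p), fun q => map_app_one f _⟩

/-- This places `d_n x` in the image of `lim F_{n+1}`, the source both of `d² = 0` and of the test
for vanishing on `K_{n+1}`. -/
theorem evalHom_constToProd (n : ℕ) (x : M deg n) :
    evalHom deg (n + 1) (constToProd deg n (F deg n).obj x ≫ projHom deg n) = d deg n x := by
  funext p
  exact congrArg (proj deg n p.1) (funext fun q => constToProd_app_one n (F deg n).obj x p.1 q)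

/-- The kernel of `d_n` is the inverse limit of `F_n`. -/
theorem IsAdequate.d_eq_zero_iff (hdeg : IsDegreeFunction deg)
    (hfin : ∀ p₀ : P, {p : P | p₀ ≤ p}.Finite) {J : P → ℕ → Set P} (hJ : IsAdequate deg J)
    (n : ℕ) (x : M deg n) : d deg n x = 0 ↔ ∃ f, evalHom deg n f = x := by
  rw [← hJ.forall_proj_eq_zero_iff hdeg hfin]
  refine ⟨fun h p => ?_, fun h => funext fun p => h p.1⟩
  rw [← evalHom_constToProd, ← map_zero (evalHom deg (n + 1))] at h
  -- The hypothesis concerns objects of degree `n + 1` only; injectivity of evaluation extends the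
  -- vanishing to all objects.
  have h' := hJ.evalHom_injective hdeg hfin (n + 1) h
  have h0 : (constToProd deg n (F deg n).obj x ≫ projHom deg n).app p (oneZ p) = 0 := by
    rw [h']
    rfl
  refine Eq.trans (congrArg (proj deg n p) (funext fun q => ?_)) h0
  exact (constToProd_app_one n (F deg n).obj x p q).symm

/-- The map is the connecting homomorphism into `Ext¹(ℤ, F_n)` followed by the iterated shift. Its
kernel is the image of `Hom(ℤ, Ker'_{F_n})`, which is `M_n` in disguise. -/
theorem IsAdequate.exists_hom_ext (hdeg : IsDegreeFunction deg)
    (hfin : ∀ p₀ : P, {p : P | p₀ ≤ p}.Finite) {J : P → ℕ → Set P} (hJ : IsAdequate deg J)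
    (n : ℕ) : ∃ a : (constZ P ⟶ F deg (n + 1)) →+
        Abelian.Ext.{u} (constZ P) (constZ P) (n + 1), Function.Surjective a ∧
      ∀ f, a f = 0 ↔ ∃ x, d deg n x = evalHom deg (n + 1) f := by
  obtain ⟨w, hS⟩ := hJ.shortExact hdeg hfin n
  obtain ⟨e⟩ := hJ.ext_addEquiv hdeg hfin n 0 n (zero_add n)
  let b : (constZ P ⟶ F deg (n + 1)) →+ Abelian.Ext.{u} (constZ P) (F deg n) 1 :=
    (hS.extClass.postcomp (constZ P) (zero_add 1)).comp
      Abelian.Ext.addEquiv₀.symm.toAddMonoidHom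
  refine ⟨e.toAddMonoidHom.comp b, e.surjective.comp fun x => ?_, fun f => ?_⟩
  · obtain ⟨y, rfl⟩ := Abelian.Ext.covariant_sequence_exact₁ _ hS x
      (ext_prodFunctor_eq_zero n _ _ _) rfl
    exact ⟨Abelian.Ext.addEquiv₀ y, by simp [b]⟩
  · change e (b f) = 0 ↔ _
    rw [EmbeddingLike.map_eq_zero_iff]
    constructor
    · intro hf
      obtain ⟨y, hy⟩ := Abelian.Ext.covariant_sequence_exact₃ _ hS _ (zero_add 1) hf
      obtain ⟨g, rfl⟩ := Abelian.Ext.addEquiv₀.symm.surjective y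
      have hg : g ≫ projHom deg n = f := by
        apply Abelian.Ext.addEquiv₀.symm.injective
        refine Eq.trans ?_ hy
        exact (Abelian.Ext.mk₀_comp_mk₀ _ _).symm
      refine ⟨fun p => (g.app p.1 (oneZ p.1) : ∀ q : above deg n p.1, (F deg n).obj q.1)
        ⟨p.1, le_rfl, p.2⟩, (evalHom_constToProd n _).symm.trans ?_⟩
      rw [← eq_constToProd, hg]
    · rintro ⟨x, hx⟩
      rw [← evalHom_constToProd] at hx
      obtain rfl := hJ.evalHom_injective hdeg hfin _ hx
      change (Abelian.Ext.mk₀ (_ ≫ _)).comp hS.extClass (zero_add 1) = 0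
      rw [← Abelian.Ext.mk₀_comp_mk₀, Abelian.Ext.comp_assoc_of_second_deg_zero,
        hS.comp_extClass, Abelian.Ext.comp_zero]

end Comparison

/-! ### Cancelling the part off `K`: the complex `B^K` -/

section Covering

variable {P : Type u} [PartialOrder P] {deg : P → ℕ}

theorem restr_incl (n : ℕ) (S : Set P) (x : MOn deg n S) : restr deg n S (incl deg n S x) = x :=
  funext fun p => dif_pos p.2.2

theorem restr_incl_compl (n : ℕ) (S : Set P) (x : MOn deg n Sᶜ) :
    restr deg n S (incl deg n Sᶜ x) = 0 :=
  funext fun p => dif_neg (not_not.2 p.2.2)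

theorem incl_restr_add (n : ℕ) (S : Set P) (x : M deg n) :
    incl deg n S (restr deg n S x) + incl deg n Sᶜ (restr deg n Sᶜ x) = x := by
  funext p
  change (incl deg n S (restr deg n S x)) p + (incl deg n Sᶜ (restr deg n Sᶜ x)) p = x p
  by_cases h : p.1 ∈ S
  · rw [show incl deg n S (restr deg n S x) p = x p from dif_pos h,
      show incl deg n Sᶜ (restr deg n Sᶜ x) p = 0 from dif_neg (not_not.2 h), add_zero]
  · rw [show incl deg n S (restr deg n S x) p = 0 from dif_neg h,
      show incl deg n Sᶜ (restr deg n Sᶜ x) p = x p from dif_pos h, zero_add]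

theorem restr_d (n : ℕ) (S T : Set P) (x : M deg n) :
    restr deg (n + 1) T (d deg n x) =
      dOn deg n S T (restr deg n S x) + dOn deg n Sᶜ T (restr deg n Sᶜ x) := by
  conv_lhs => rw [← incl_restr_add n S x, map_add, map_add]
  rfl

theorem IsAdequate.d_d (hdeg : IsDegreeFunction deg)
    (hfin : ∀ p₀ : P, {p : P | p₀ ≤ p}.Finite) {J : P → ℕ → Set P} (hJ : IsAdequate deg J)
    (n : ℕ) (x : M deg n) : d deg (n + 1) (d deg n x) = 0 :=
  (hJ.d_eq_zero_iff hdeg hfin _ _).2 ⟨_, evalHom_constToProd n x⟩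

/-- In `d² = 0` the paths through `T` and through its complement cancel. This yields both that `d_n`
descends to `B^K` and that `Ω² = 0`. -/
theorem IsAdequate.dOn_dOn (hdeg : IsDegreeFunction deg)
    (hfin : ∀ p₀ : P, {p : P | p₀ ≤ p}.Finite) {J : P → ℕ → Set P} (hJ : IsAdequate deg J)
    (n : ℕ) (S T U : Set P) (x : MOn deg n S) :
    dOn deg (n + 1) T U (dOn deg n S T x) = - dOn deg (n + 1) Tᶜ U (dOn deg n S Tᶜ x) := by
  rw [eq_neg_iff_add_eq_zero]
  have := restr_d (n + 1) T U (d deg n (incl deg n S x))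
  rw [hJ.d_d hdeg hfin, map_zero] at this
  exact this.symm

variable {K : ℕ → Set P}

theorem IsGlobalCoveringFamily.eq_zero_of_restr_evalHom (hK : IsGlobalCoveringFamily deg K)
    (n : ℕ) (f : constZ P ⟶ F deg n) (h : restr deg n (K n) (evalHom deg n f) = 0) : f = 0 := by
  refine (injective_iff_map_eq_zero _).1 (toLim_bijective (F deg n)).1 f ?_
  refine (injective_iff_map_eq_zero _).1 (hK.injective n) _ (funext fun p => ?_)
  exact (limit_π_toLim f p.1).trans (congrFun h p)

theorem IsGlobalCoveringFamily.d_eq_zero (hK : IsGlobalCoveringFamily deg K)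
    (n : ℕ) (x : M deg n) (h : restr deg (n + 1) (K (n + 1)) (d deg n x) = 0) :
    d deg n x = 0 := by
  rw [← evalHom_constToProd] at h ⊢
  rw [hK.eq_zero_of_restr_evalHom _ _ h, map_zero]

/-- If `d_n x` vanishes on `K_{n+1}` it vanishes altogether, so `x` comes from `lim F_n`; being zero
on `K_n`, it is zero. -/
theorem IsGlobalCoveringFamily.dOn_injective (hK : IsGlobalCoveringFamily deg K)
    (hdeg : IsDegreeFunction deg) (hfin : ∀ p₀ : P, {p : P | p₀ ≤ p}.Finite)
    {J : P → ℕ → Set P} (hJ : IsAdequate deg J) (n : ℕ) :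
    Function.Injective (dOn deg n (K n)ᶜ (K (n + 1))) := by
  rw [injective_iff_map_eq_zero]
  intro x hx
  obtain ⟨f, hf⟩ := (hJ.d_eq_zero_iff hdeg hfin _ _).1 (hK.d_eq_zero n _ hx)
  have h0 : f = 0 := hK.eq_zero_of_restr_evalHom n f (by rw [hf, restr_incl_compl])
  rw [← restr_incl n (K n)ᶜ x, ← hf, h0, map_zero, map_zero]

/-- An injective homomorphism with free cokernel has a retraction. -/
theorem IsPure.exists_retraction {A B : Type u} [AddCommGroup A] [AddCommGroup B] {f : A →+ B}
    (hf : IsPure f) (hinj : Function.Injective f) :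
    ∃ r : B →+ A, r.comp f = AddMonoidHom.id A := by
  have : Module.Free ℤ (B ⧸ f.range) := hf
  let q : B →ₗ[ℤ] B ⧸ f.range := (QuotientAddGroup.mk' f.range).toIntLinearMap
  obtain ⟨s, hs⟩ := Module.projective_lifting_property q LinearMap.id
    (QuotientAddGroup.mk'_surjective f.range)
  have hmem : ∀ b, b - s (q b) ∈ f.range := fun b => by
    refine (QuotientAddGroup.eq_zero_iff _).1 ?_
    change q (b - s (q b)) = 0
    rw [map_sub, show q (s (q b)) = q b from LinearMap.congr_fun hs (q b), sub_self]
  let e := AddMonoidHom.ofInjective hinj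
  refine ⟨e.symm.toAddMonoidHom.comp
    ((AddMonoidHom.id B - (s.comp q).toAddMonoidHom).codRestrict f.range hmem), ?_⟩
  ext a
  refine e.symm_apply_eq.2 (Subtype.ext ?_)
  have hq : q (f a) = 0 := (QuotientAddGroup.eq_zero_iff _).2 ⟨a, rfl⟩
  change f a - s (q (f a)) = f a
  rw [hq, map_zero, sub_zero]

/-- The differentials `d_n` descend to the groups `B_n^K`. -/
theorem IsAdequate.nonCriticalImage_le (hdeg : IsDegreeFunction deg)
    (hfin : ∀ p₀ : P, {p : P | p₀ ≤ p}.Finite) {J : P → ℕ → Set P} (hJ : IsAdequate deg J)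
    (n : ℕ) : nonCriticalImage deg K n ≤
      (nonCriticalImage deg K (n + 1)).comap (dOn deg n (K n) (K (n + 1))) := by
  cases n with
  | zero => exact bot_le
  | succ n =>
    rintro _ ⟨x, rfl⟩
    change dOn deg _ _ _ _ ∈ nonCriticalImage deg K _
    rw [hJ.dOn_dOn hdeg hfin]
    exact neg_mem ⟨_, rfl⟩

theorem B.mk_surjective (n : ℕ) : Function.Surjective (B.mk deg K n) :=
  QuotientAddGroup.mk'_surjective _

theorem B.mk_eq_zero_iff (n : ℕ) (x : MOn deg n (K n)) :
    B.mk deg K n x = 0 ↔ x ∈ nonCriticalImage deg K n := QuotientAddGroup.eq_zero_iff x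

theorem B.mk_dOn_compl (n : ℕ) (x : MOn deg n (K n)ᶜ) :
    B.mk deg K (n + 1) (dOn deg n (K n)ᶜ (K (n + 1)) x) = 0 :=
  (B.mk_eq_zero_iff _ _).2 ⟨x, rfl⟩

theorem B.mk_restr_d (n : ℕ) (Ω : B deg K n ⟶ B deg K (n + 1))
    (hΩ : ∀ x : MOn deg n (K n),
      Ω (B.mk deg K n x) = B.mk deg K (n + 1) (dOn deg n (K n) (K (n + 1)) x)) (x : M deg n) :
    B.mk deg K (n + 1) (restr deg (n + 1) (K (n + 1)) (d deg n x)) =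
      Ω (B.mk deg K n (restr deg n (K n) x)) := by
  rw [restr_d n (K n), map_add, B.mk_dOn_compl, add_zero, hΩ]

/-- The cocycles of the complex `B^K` are represented by the inverse limit of `F_n`. -/
theorem IsGlobalCoveringFamily.exists_evalHom (hK : IsGlobalCoveringFamily deg K)
    (hdeg : IsDegreeFunction deg) (hfin : ∀ p₀ : P, {p : P | p₀ ≤ p}.Finite)
    {J : P → ℕ → Set P} (hJ : IsAdequate deg J) (n : ℕ) (Ω : B deg K n ⟶ B deg K (n + 1))
    (hΩ : ∀ x : MOn deg n (K n),
      Ω (B.mk deg K n x) = B.mk deg K (n + 1) (dOn deg n (K n) (K (n + 1)) x))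
    (b : B deg K n) (hb : Ω b = 0) :
    ∃ f, B.mk deg K n (restr deg n (K n) (evalHom deg n f)) = b := by
  obtain ⟨x, rfl⟩ := B.mk_surjective n b
  rw [hΩ, B.mk_eq_zero_iff] at hb
  obtain ⟨w, hw⟩ := hb
  -- The correction `w` lives off `K_n`, so it makes the cochain a cocycle of `M` without changing
  -- its restriction to `K_n`.
  obtain ⟨f, hf⟩ := (hJ.d_eq_zero_iff hdeg hfin n
    (incl deg n (K n) x - incl deg n (K n)ᶜ w)).1 (hK.d_eq_zero n _ (by
      rw [map_sub, map_sub]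
      exact sub_eq_zero.2 hw.symm))
  exact ⟨f, by rw [hf, map_sub, restr_incl, restr_incl_compl, sub_zero]⟩

theorem IsGlobalCoveringFamily.exists_d_eq_iff (hK : IsGlobalCoveringFamily deg K)
    (n : ℕ) (Ω : B deg K n ⟶ B deg K (n + 1))
    (hΩ : ∀ x : MOn deg n (K n),
      Ω (B.mk deg K n x) = B.mk deg K (n + 1) (dOn deg n (K n) (K (n + 1)) x))
    (f : constZ P ⟶ F deg (n + 1)) :
    (∃ x, d deg n x = evalHom deg (n + 1) f) ↔
      ∃ y, Ω y = B.mk deg K (n + 1) (restr deg (n + 1) (K (n + 1)) (evalHom deg (n + 1) f)) := by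
  constructor
  · rintro ⟨x, hx⟩
    exact ⟨B.mk deg K n (restr deg n (K n) x), by rw [← B.mk_restr_d n Ω hΩ, hx]⟩
  · rintro ⟨y, hy⟩
    obtain ⟨y, rfl⟩ := B.mk_surjective n y
    rw [hΩ, ← sub_eq_zero, ← map_sub, B.mk_eq_zero_iff] at hy
    obtain ⟨w, hw⟩ := hy
    -- With this correction both sides agree on `K_{n+1}`; both come from `lim F_{n+1}`, so they are
    -- equal.
    refine ⟨incl deg n (K n) y - incl deg n (K n)ᶜ w, ?_⟩
    rw [← sub_eq_zero, ← evalHom_constToProd, ← map_sub]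
    refine (congrArg (evalHom deg (n + 1)) (hK.eq_zero_of_restr_evalHom _ _ ?_)).trans
      (map_zero _)
    rw [map_sub, map_sub, evalHom_constToProd, map_sub, map_sub, sub_right_comm]
    exact sub_eq_zero.2 hw.symm

theorem homology_of_zero_addEquiv (X : ℕ → AddCommGrpCat.{u}) (Ω : ∀ n, X n ⟶ X (n + 1))
    (hΩ : ∀ n, Ω n ≫ Ω (n + 1) = 0) {G : Type u} [AddCommGroup G] (z : G →+ X 0)
    (hz : ∀ g, Ω 0 (z g) = 0) (hz' : ∀ x, Ω 0 x = 0 → ∃ g, z g = x)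
    (hinj : ∀ g, z g = 0 → g = 0) :
    Nonempty ((CochainComplex.of X Ω hΩ).homology 0 ≃+ G) := by
  let C := CochainComplex.of X Ω hΩ
  have hC : C.d 0 1 = Ω 0 := CochainComplex.of_d X Ω 0
  -- In degree `0` the predecessor index is `0` by convention, and the differential from `0` to `0`
  -- is zero.
  refine homology_addEquiv C (i := 0) (n := 0) (by simp) z (fun g => by rw [hC]; exact hz g)
    (fun x hx => ?_) (AddMonoidHom.id G) Function.surjective_id fun g => ?_
  · rw [hC] at hx
    obtain ⟨g, rfl⟩ := hz' x hx
    exact ⟨g, 0, by rw [map_zero, add_zero]⟩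
  · rw [C.shape 0 0 (by simp)]
    constructor
    · rintro rfl
      exact ⟨0, by rw [map_zero, map_zero]⟩
    · rintro ⟨y, hy⟩
      exact hinj g hy.symm

theorem homology_of_succ_addEquiv (X : ℕ → AddCommGrpCat.{u}) (Ω : ∀ n, X n ⟶ X (n + 1))
    (hΩ : ∀ n, Ω n ≫ Ω (n + 1) = 0) {n : ℕ} {G A : Type u} [AddCommGroup G] [AddCommGroup A]
    (z : G →+ X (n + 1)) (hz : ∀ g, Ω (n + 1) (z g) = 0)
    (hz' : ∀ x, Ω (n + 1) x = 0 → ∃ g, z g = x)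
    (a : G →+ A) (hsurj : Function.Surjective a) (ha : ∀ g, a g = 0 ↔ ∃ y, Ω n y = z g) :
    Nonempty ((CochainComplex.of X Ω hΩ).homology (n + 1) ≃+ A) := by
  let C := CochainComplex.of X Ω hΩ
  have hC : ∀ n, C.d n (n + 1) = Ω n := CochainComplex.of_d X Ω
  refine homology_addEquiv C (i := n) (n := n + 1) (by simp) z (fun g => by rw [hC]; exact hz g)
    (fun x hx => ?_) a hsurj fun g => by rw [hC]; exact ha g
  rw [hC] at hx
  obtain ⟨g, rfl⟩ := hz' x hx
  exact ⟨g, 0, by rw [map_zero, add_zero]⟩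

/-- The class in `B_n^K` of an element of the inverse limit of `F_n`. -/
noncomputable def limToB (deg : P → ℕ) (K : ℕ → Set P) (n : ℕ) :
    (constZ P ⟶ F deg n) →+ B deg K n :=
  (B.mk deg K n).comp ((restr deg n (K n)).comp (evalHom deg n))

theorem IsAdequate.map_limToB (hdeg : IsDegreeFunction deg)
    (hfin : ∀ p₀ : P, {p : P | p₀ ≤ p}.Finite) {J : P → ℕ → Set P} (hJ : IsAdequate deg J)
    (n : ℕ) (Ω : B deg K n ⟶ B deg K (n + 1))
    (hΩ : ∀ x : MOn deg n (K n),
      Ω (B.mk deg K n x) = B.mk deg K (n + 1) (dOn deg n (K n) (K (n + 1)) x))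
    (f : constZ P ⟶ F deg n) : Ω (limToB deg K n f) = 0 := by
  have h := B.mk_restr_d n Ω hΩ (evalHom deg n f)
  rw [(hJ.d_eq_zero_iff hdeg hfin n _).2 ⟨f, rfl⟩, map_zero, map_zero] at h
  exact h.symm

set_option maxHeartbeats 1000000 in
/-- The cohomology of the complex `B^K` is that of the poset. -/
theorem IsGlobalCoveringFamily.homology_iso (hK : IsGlobalCoveringFamily deg K)
    (hdeg : IsDegreeFunction deg) (hfin : ∀ p₀ : P, {p : P | p₀ ≤ p}.Finite)
    {J : P → ℕ → Set P} (hJ : IsAdequate deg J) (Ω : ∀ n, B deg K n ⟶ B deg K (n + 1))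
    (hΩ : ∀ n, Ω n ≫ Ω (n + 1) = 0)
    (hind : ∀ n (x : MOn deg n (K n)),
      Ω n (B.mk deg K n x) = B.mk deg K (n + 1) (dOn deg n (K n) (K (n + 1)) x)) (n : ℕ) :
    Nonempty ((CochainComplex.of (B deg K) Ω hΩ).homology n ≅ integralCohomology P n) := by
  have hz := fun n => hJ.map_limToB hdeg hfin n (Ω n) (hind n)
  have hz' := fun n => hK.exists_evalHom hdeg hfin hJ n (Ω n) (hind n)
  cases n with
  | zero =>
    obtain ⟨e⟩ := homology_of_zero_addEquiv (B deg K) Ω hΩ (limToB deg K 0) (hz 0) (hz' 0)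
      fun f hf => hK.eq_zero_of_restr_evalHom 0 f ((B.mk_eq_zero_iff 0 _).1 hf)
    exact ⟨(e.trans (AddEquiv.ofBijective _ (toLim_bijective (constZ P)))).toAddCommGrpIso ≪≫
      ((lim : (P ⥤ AddCommGrpCat.{u}) ⥤ _).rightDerivedZeroIsoSelf.app (constZ P)).symm⟩
  | succ n =>
    obtain ⟨a, ha, ha'⟩ := hJ.exists_hom_ext hdeg hfin n
    obtain ⟨e⟩ := homology_of_succ_addEquiv (B deg K) Ω hΩ (limToB deg K (n + 1)) (hz (n + 1))
      (hz' (n + 1)) a ha fun f => (ha' f).trans (hK.exists_d_eq_iff n (Ω n) (hind n) f)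
    obtain ⟨e'⟩ := rightDerived_lim_addEquiv_ext (constZ P) n
    exact ⟨(e.trans e'.symm).toAddCommGrpIso⟩

end Covering

/-! ### Betti numbers -/

section Ranks

/-- The rank of a product of free groups, all but finitely many of which vanish. -/
theorem free_finite_finrank_pi {ι : Type*} (G : ι → Type*) [∀ i, AddCommGroup (G i)]
    [∀ i, Module.Free ℤ (G i)] [∀ i, Module.Finite ℤ (G i)]
    (h : (Function.support fun i => (Module.finrank ℤ (G i) : ℤ)).Finite) :
    Module.Free ℤ (∀ i, G i) ∧ Module.Finite ℤ (∀ i, G i) ∧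
      (Module.finrank ℤ (∀ i, G i) : ℤ) = ∑ᶠ i, (Module.finrank ℤ (G i) : ℤ) := by
  classical
  set S := Function.support fun i => (Module.finrank ℤ (G i) : ℤ) with hSdef
  -- A free group of rank zero is trivial, so these factors can be dropped even from an infinite
  -- product.
  have hS : ∀ i ∉ S, Subsingleton (G i) := fun i hi => by
    rw [← Module.finrank_eq_zero_iff_of_free ℤ]
    simpa [S] using hi
  let r : (∀ i, G i) →ₗ[ℤ] (∀ i : S, G i) := LinearMap.pi fun i => LinearMap.proj i.1
  have hr : Function.Bijective r := by
    constructor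
    · rw [injective_iff_map_eq_zero]
      intro x hx
      funext i
      by_cases hi : i ∈ S
      · exact congrFun hx ⟨i, hi⟩
      · have := hS i hi
        exact Subsingleton.elim _ _
    · intro y
      refine ⟨fun i => if hi : i ∈ S then y ⟨i, hi⟩ else 0, funext fun i => ?_⟩
      exact dif_pos i.2
  let e := LinearEquiv.ofBijective r hr
  have := h.to_subtype
  have : Module.Finite ℤ (∀ i : S, G i) := Module.Finite.pi
  refine ⟨Module.Free.of_equiv e.symm, Module.Finite.equiv e.symm, ?_⟩
  rw [e.finrank_eq, finsum_mem_coe_finrank S h, hSdef, finsum_mem_support]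

variable {P : Type u} [PartialOrder P] {deg : P → ℕ}

theorem free_finite_finrank_MOn {n : ℕ} (hrank : ∀ p, HasRank deg n p) (S : Set P)
    (hS : ({p | deg p = n ∧ p ∈ S} ∩ Function.support (R deg n)).Finite) :
    Module.Free ℤ (MOn deg n S) ∧ Module.Finite ℤ (MOn deg n S) ∧
      (Module.finrank ℤ (MOn deg n S) : ℤ) = ∑ᶠ p ∈ {p | deg p = n ∧ p ∈ S}, R deg n p := by
  have hfree := fun q => (hrank q).free
  have hfinite := fun q => (hrank q).finite
  obtain ⟨h1, h2, h3⟩ := free_finite_finrank_pi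
    (fun p : {p : P // deg p = n ∧ p ∈ S} => (F deg n).obj p.1) (by
      refine (hS.preimage Subtype.val_injective.injOn).subset fun p hp => ⟨p.2, ?_⟩
      rw [Function.mem_support, (hrank p.1).finrank_eq] at hp
      exact hp)
  refine ⟨h1, h2, h3.trans ?_⟩
  rw [← finsum_set_coe_eq_finsum_mem]
  exact finsum_congr fun p => (hrank p.1).finrank_eq

theorem finrank_quotient_range {A B : Type u} [AddCommGroup A] [AddCommGroup B]
    [Module.Finite ℤ B] (f : A →+ B) (hf : Function.Injective f) :
    Module.finrank ℤ (B ⧸ f.range) + Module.finrank ℤ A = Module.finrank ℤ B := by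
  let q : B →ₗ[ℤ] B ⧸ f.range := (QuotientAddGroup.mk' f.range).toIntLinearMap
  have hq : q.range = ⊤ := LinearMap.range_eq_top.2 (QuotientAddGroup.mk'_surjective f.range)
  have hker : q.ker = f.toIntLinearMap.range := by
    ext x
    exact QuotientAddGroup.eq_zero_iff (N := f.range) x
  have h := Submodule.finrank_quotient_add_finrank q.ker
  rw [q.quotKerEquivRange.finrank_eq, hq, finrank_top, hker,
    LinearMap.finrank_range_of_inj (f := f.toIntLinearMap) hf] at h
  exact h

theorem nonneg_and_addEquiv_of_finrank_eq {A : Type*} [AddCommGroup A] [Module.Free ℤ A]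
    [Module.Finite ℤ A] {b : ℤ} (h : (Module.finrank ℤ A : ℤ) = b) :
    0 ≤ b ∧ Nonempty (A ≃+ (Fin b.toNat → ℤ)) := by
  subst h
  exact ⟨Int.natCast_nonneg _, ⟨(Module.finBasis ℤ A).equivFun.toAddEquiv⟩⟩

/-- For `n + 1` the rank of the cokernel is that of the target minus that of the injected part off
`K_n`, and the latter is the full sum in degree `n` minus the sum over `K_n`. Nonnegativity holds
because the Betti number is a rank. -/
theorem IsGlobalCoveringFamily.nonneg_betti_and_addEquiv {K : ℕ → Set P}
    (hK : IsGlobalCoveringFamily deg K)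
    (hdeg : IsDegreeFunction deg) (hfin : ∀ p₀ : P, {p : P | p₀ ≤ p}.Finite)
    {J : P → ℕ → Set P} (hJ : IsAdequate deg J) (n : ℕ) (h : BettiDefined deg K n) :
    0 ≤ betti deg K n ∧ Nonempty (B deg K n ≃+ (Fin (betti deg K n).toNat → ℤ)) := by
  have hrank := fun n => (hJ.isDetectedBy_and_hasRank hdeg hfin n).2
  have hset : ∀ n, {p | deg p = n ∧ p ∈ K n} = K n := fun n =>
    Set.ext fun p => ⟨fun hp => hp.2, fun hp => ⟨hK.deg_eq n p hp, hp⟩⟩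
  cases n with
  | zero =>
    obtain ⟨h1, h2, h3⟩ := free_finite_finrank_MOn (hrank 0) (K 0) (by rw [hset]; exact h)
    rw [hset] at h3
    obtain ⟨h4, ⟨e⟩⟩ := nonneg_and_addEquiv_of_finrank_eq (b := betti deg K 0) h3
    exact ⟨h4, ⟨(QuotientAddGroup.quotientBot (G := MOn deg 0 (K 0))).trans e⟩⟩
  | succ n =>
    obtain ⟨hn, hn'⟩ := h
    obtain ⟨h1, h2, h3⟩ := free_finite_finrank_MOn (hrank (n + 1)) (K (n + 1))
      (by rw [hset]; exact hn')
    obtain ⟨h4, h5, h6⟩ := free_finite_finrank_MOn (hrank n) (K n)ᶜ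
      (hn.subset fun p hp => ⟨hp.1.1, hp.2⟩)
    have hfree : Module.Free ℤ (MOn deg (n + 1) (K (n + 1)) ⧸
      (dOn deg n (K n)ᶜ (K (n + 1))).range) := hK.isPure n
    have hfinite : Module.Finite ℤ (MOn deg (n + 1) (K (n + 1)) ⧸
        (dOn deg n (K n)ᶜ (K (n + 1))).range) :=
      Module.Finite.of_surjective (QuotientAddGroup.mk' _).toIntLinearMap
        (QuotientAddGroup.mk'_surjective _)
    have hquot := finrank_quotient_range _ (hK.dOn_injective hdeg hfin hJ n)
    have hunion : K n ∪ {p | deg p = n ∧ p ∈ (K n)ᶜ} = {p | deg p = n} := by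
      ext p
      have := hK.deg_eq n p
      by_cases hp : p ∈ K n <;> simp [hp, this]
    have hsum := finsum_mem_union' (f := R deg n) (s := K n) (t := {p | deg p = n ∧ p ∈ (K n)ᶜ})
      (Set.disjoint_left.2 fun p hp hp' => hp'.2 hp)
      (hn.subset fun p hp => ⟨hK.deg_eq n p hp.1, hp.2⟩)
      (hn.subset fun p hp => ⟨hp.1.1, hp.2⟩)
    rw [hunion] at hsum
    rw [hset] at h3
    refine nonneg_and_addEquiv_of_finrank_eq (A := MOn deg (n + 1) (K (n + 1)) ⧸
      (dOn deg n (K n)ᶜ (K (n + 1))).range) ?_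
    rw [betti]
    zify at hquot
    linarith

end Ranks

end PosetCohomology

open PosetCohomology
set_option maxHeartbeats 1000000 in
theorem theorem5p5 {P : Type u} [PartialOrder P] (deg : P → ℕ)
    (hdeg : IsDegreeFunction deg) (hfin : ∀ p₀ : P, {p : P | p₀ ≤ p}.Finite)
    (hJ : ∃ J : P → ℕ → Set P, IsAdequate deg J)
    (K : ℕ → Set P) (hK : IsGlobalCoveringFamily deg K) :
    -- the non-critical part of degree `n` splits off from the critical part of degree `n + 1`
    (∀ n, ∃ r : MOn deg (n + 1) (K (n + 1)) →+ MOn deg n (K n)ᶜ,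
      r.comp (dOn deg n (K n)ᶜ (K (n + 1))) = AddMonoidHom.id _) ∧
    ∃ (Ω : ∀ n, B deg K n ⟶ B deg K (n + 1)) (hΩ : ∀ n, Ω n ≫ Ω (n + 1) = 0),
      -- the differentials are induced by the differentials `d_n`
      (∀ n (x : MOn deg n (K n)),
        Ω n (B.mk deg K n x) = B.mk deg K (n + 1) (dOn deg n (K n) (K (n + 1)) x)) ∧
      -- the ranks
      (∀ n, BettiDefined deg K n → 0 ≤ betti deg K n ∧
        Nonempty (B deg K n ≃+ (Fin (betti deg K n).toNat → ℤ))) ∧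
      -- the cohomology
      (∀ n, Nonempty ((CochainComplex.of (B deg K) Ω hΩ).homology n ≅ integralCohomology P n)) := by
  obtain ⟨J, hJ⟩ := hJ
  let Ω : ∀ n, B deg K n ⟶ B deg K (n + 1) := fun n => AddCommGrpCat.ofHom
    (QuotientAddGroup.map _ _ (dOn deg n (K n) (K (n + 1))) (hJ.nonCriticalImage_le hdeg hfin n))
  have hind : ∀ n (x : MOn deg n (K n)),
      Ω n (B.mk deg K n x) = B.mk deg K (n + 1) (dOn deg n (K n) (K (n + 1)) x) :=
    fun n x => rfl
  have hΩ : ∀ n, Ω n ≫ Ω (n + 1) = 0 := by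
    intro n
    ext b
    obtain ⟨x, rfl⟩ := B.mk_surjective n b
    rw [ConcreteCategory.comp_apply, hind, hind, hJ.dOn_dOn hdeg hfin, map_neg, B.mk_dOn_compl,
      neg_zero]
    rfl
  exact ⟨fun n => (hK.isPure n).exists_retraction (hK.dOn_injective hdeg hfin hJ n), Ω, hΩ, hind,
    hK.nonneg_betti_and_addEquiv hdeg hfin hJ, hK.homology_iso hdeg hfin hJ Ω hΩ hind⟩
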